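/- Let $n\ge 3$. Let $\mathbb{Q}_n=\{[x^0:\dots:x^{n+1}] : \sum_{A=1}^n (x^A)^2-2x^0x^{n+1}=0\}\subset\mathbb{P}^{n+1}(\mathbb{R})$ be the Darboux hyperquadric, let $\mathrm{M\ddot{o}b}(n)$ be the identity component of the group of linear transformations of $\mathbb{R}^{n+2}$ preserving this quadratic form, and let $\pi:\mathrm{M\ddot{o}b}(n)\to\mathbb{Q}_n$ send a matrix $G$ to the class $[G\eta_0]$ of its first column (columns and rows are numbered $0,\dots,n+1$). Put $\alpha\in\{2,\dots,n\}$, $b\in\{3,\dots,n\}$. A frame along an immersion $f$ of an interval on an open set $U$ is a smooth $e:U\to\mathrm{M\ddot{o}b}(n)$ with $\pi\circ e=f|_U$; put $\phi=e^{-1}de$. It is a first order frame if $\phi^\alpha_0=0$ and $\phi^1_0$ is positive on the positive direction of the interval; a second order frame if moreover $\phi^\alpha_1=0$; a third order frame if moreover $\phi^0_2=\phi^1_0$ and $\phi^0_b=0$; and a special third order frame if moreover $\phi^0_0=0$. A smooth immersion $f$ is $1$-generic if at every point, writing $\phi^0_\alpha=p^\alpha\phi^1_0$ for a second order frame around that point,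 $\sum_\alpha (p^\alpha)^2\ne 0$. Let $I\subset\mathbb{R}$ be an open interval and let $f:I\to\mathbb{Q}_n$ be a smooth $1$-generic immersion. Then every $p\in I$ has an open neighbourhood $U\subset I$ with the following property. For every compact set $C\subset U$ and all smooth functions $\lambda^\alpha\in C^\infty(I)$, $2\le\alpha\le n$, vanishing outside $C$, there exist $\varepsilon>0$, a compact set $K\subset U$ and smooth maps $v:I\times(-\varepsilon,\varepsilon)\to\mathbb{Q}_n$ and $e:U\times(-\varepsilon,\varepsilon)\to\mathrm{M\ddot{o}b}(n)$ such that: 1. $v$ is an admissible variation of $f$ supported in $K$: each $f_t=v(\cdot,t)$ is a $1$-generic immersion, $v(\cdot,0)=f$, and $v(x,t)=f(x)$ for all $x\in I\setminus K$ and $|t|<\varepsilon$; 2. $e$ is a special third order frame along $v$: $\pi\circ e=v$ on $U\times(-\varepsilon,\varepsilon)$, $e(x,t)=e(x,0)$ for all $x\in U\setminus K$ and $|t|<\varepsilon$, and for each $t$ the map $e(\cdot,t)$ is a special third order frame along $f_t$ on $U$; 3. writing $\lambda^\alpha_0(x,t)=\left(e^{-1}\tfrac{\partial e}{\partial t}\right)^\alpha_0(x,t)$,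 one has $\lambda^\alpha_0(x,0)=\lambda^\alpha(x)$ for every $x\in U$ and every $\alpha$. -/

import Mathlib

open scoped ContDiff LinearAlgebra.Projectivization Matrix

namespace ConformalCurves

noncomputable section

/-- The matrix `S` of the Lorentzian product on `ℝ^{n+2}` in the standard basis
`η_0, η_1, …, η_{n+1}`: `⟨x, x⟩ = ∑_A (x^A)^2 - 2 x^0 x^{n+1}`. -/
def lorentzMatrix (n : ℕ) : Matrix (Fin (n + 2)) (Fin (n + 2)) ℝ :=
  Matrix.of fun i j =>
    if (i = 0 ∧ j = Fin.last (n + 1)) ∨ (i = Fin.last (n + 1) ∧ j = 0) then -1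
    else if i = j ∧ i ≠ 0 ∧ i ≠ Fin.last (n + 1) then 1 else 0

/-- The quadratic form `∑_A (x^A)^2 - 2 x^0 x^{n+1}`. -/
def lorentzForm (n : ℕ) (x : Fin (n + 2) → ℝ) : ℝ :=
  x ⬝ᵥ (lorentzMatrix n *ᵥ x)

/-- The Darboux hyperquadric `Q_n` in the real projective space of dimension `n + 1`. -/
def DarbouxQuadric (n : ℕ) : Type :=
  {P : ℙ ℝ (Fin (n + 2) → ℝ) // lorentzForm n P.rep = 0}

/-- The Lorentz group of the product with matrix `S`. -/
def lorentzGroup (n : ℕ) : Set (Matrix (Fin (n + 2)) (Fin (n + 2)) ℝ) :=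
  {G | Gᵀ * lorentzMatrix n * G = lorentzMatrix n}

/-- The Möbius group: the identity component of the Lorentz group. -/
def MobiusGroup (n : ℕ) : Type :=
  {G : Matrix (Fin (n + 2)) (Fin (n + 2)) ℝ // G ∈ connectedComponentIn (lorentzGroup n) 1}

theorem lorentzForm_smul (n : ℕ) (a : ℝ) (x : Fin (n + 2) → ℝ) :
    lorentzForm n (a • x) = a ^ 2 * lorentzForm n x := by
  simp only [lorentzForm, Matrix.mulVec_smul, smul_dotProduct, dotProduct_smul, smul_eq_mul]
  ring

theorem lorentzForm_eq (n : ℕ) (x : Fin (n + 2) → ℝ) :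
    lorentzForm n x =
      ∑ A : Fin n, x A.succ.castSucc ^ 2 - 2 * x 0 * x (Fin.last (n + 1)) := by
  have h0 : (0 : Fin (n + 2)) ≠ Fin.last (n + 1) := (Fin.last_pos).ne
  have key : ∀ g : Fin (n + 2) → ℝ,
      ∑ i, g i = g 0 + ∑ A : Fin n, g A.succ.castSucc + g (Fin.last (n + 1)) := by
    intro g
    rw [Fin.sum_univ_castSucc, Fin.sum_univ_succ]
    simp
  simp only [lorentzForm, dotProduct, Matrix.mulVec, lorentzMatrix, Matrix.of_apply, key]
  simp [h0, h0.symm, pow_two]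
  ring

theorem MobiusGroup.mem_lorentzGroup {n : ℕ} (G : MobiusGroup n) : G.1 ∈ lorentzGroup n :=
  connectedComponentIn_subset _ _ G.2

theorem MobiusGroup.col_zero_ne_zero {n : ℕ} (G : MobiusGroup n) : G.1.col 0 ≠ 0 := by
  intro h
  have hG := congrFun (congrFun G.mem_lorentzGroup (Fin.last (n + 1))) 0
  have hc : ∀ i, G.1 i 0 = 0 := fun i => congrFun h i
  rw [Matrix.mul_apply] at hG
  simp [hc, lorentzMatrix] at hG

theorem MobiusGroup.lorentzForm_col_zero {n : ℕ} (G : MobiusGroup n) :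
    lorentzForm n (G.1.col 0) = 0 := by
  have hG := congrFun (congrFun G.mem_lorentzGroup 0) 0
  have h0 : (0 : Fin (n + 2)) ≠ Fin.last (n + 1) := (Fin.last_pos).ne
  have hS : lorentzMatrix n 0 0 = 0 := by simp [lorentzMatrix, h0]
  rw [hS, Matrix.mul_assoc, Matrix.mul_apply] at hG
  exact hG

/-- The bundle projection `π : Möb(n) → Q_n`, `G ↦ [G η_0] = [g_0]`. -/
def MobiusGroup.proj {n : ℕ} (G : MobiusGroup n) : DarbouxQuadric n :=
  ⟨Projectivization.mk ℝ (G.1.col 0) G.col_zero_ne_zero, by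
    obtain ⟨a, ha⟩ := Projectivization.exists_smul_eq_mk_rep ℝ (G.1.col 0) G.col_zero_ne_zero
    rw [← ha]
    change lorentzForm n ((a : ℝ) • G.1.col 0) = 0
    rw [lorentzForm_smul, G.lorentzForm_col_zero, mul_zero]⟩

/-- The coordinates of the affine chart `x^0 + x^{n+1} ≠ 0` of the projective space: the
homogeneous coordinates of the point, normalized by `x^0 + x^{n+1} = 1`. This one chart contains
the whole quadric (see `DarbouxQuadric.coord_sum`), so it describes the smooth structure that
`Q_n` has as a submanifold of the projective space. -/
def DarbouxQuadric.coord {n : ℕ} (P : DarbouxQuadric n) : Fin (n + 2) → ℝ :=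
  (P.1.rep 0 + P.1.rep (Fin.last (n + 1)))⁻¹ • P.1.rep

theorem sum_ne_zero_of_lorentzForm_eq_zero {n : ℕ} {x : Fin (n + 2) → ℝ} (hx : x ≠ 0)
    (h : lorentzForm n x = 0) : x 0 + x (Fin.last (n + 1)) ≠ 0 := by
  intro hs
  apply hx
  rw [lorentzForm_eq] at h
  have hl : x (Fin.last (n + 1)) = -x 0 := by linarith
  have hnn : ∀ A ∈ Finset.univ, (0 : ℝ) ≤ x (Fin.castSucc (Fin.succ (A : Fin n))) ^ 2 :=
    fun A _ => sq_nonneg _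
  have hsum := Finset.sum_nonneg hnn
  rw [hl] at h
  have h0 : x 0 = 0 := by nlinarith [sq_nonneg (x 0)]
  rw [h0] at h hl
  have hz := (Finset.sum_eq_zero_iff_of_nonneg hnn).1 (by linarith)
  funext i
  refine Fin.lastCases ?_ (fun j => ?_) i
  · simpa using hl
  · refine Fin.cases ?_ (fun A => ?_) j
    · simpa using h0
    · simpa using hz A (Finset.mem_univ A)

theorem DarbouxQuadric.coord_sum {n : ℕ} (P : DarbouxQuadric n) :
    P.coord 0 + P.coord (Fin.last (n + 1)) = 1 := by
  have h := sum_ne_zero_of_lorentzForm_eq_zero P.1.rep_nonzero P.2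
  simp only [DarbouxQuadric.coord, Pi.smul_apply, smul_eq_mul]
  rw [← mul_add, inv_mul_cancel₀ h]

/-- The range `2 ≤ α ≤ n` of the index `α` among `0, 1, …, n + 1`; it has `n - 1` elements. -/
abbrev NormalIndex (n : ℕ) : Type :=
  {i : Fin (n + 2) // 2 ≤ (i : ℕ) ∧ (i : ℕ) ≤ n}

/-- `f : I → Q_n` is a smooth immersion. -/
def IsSmoothImmersionOn {n : ℕ} (f : ℝ → DarbouxQuadric n) (I : Set ℝ) : Prop :=
  ContDiffOn ℝ ∞ (fun x => (f x).coord) I ∧ ∀ x ∈ I, deriv (fun y => (f y).coord) x ≠ 0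

/-- The pulled back Maurer–Cartan form `φ = e⁻¹ de` of a curve `e` in the Möbius group, evaluated
on the coordinate vector `d/dx`. The entry in row `a` and column `b` is `φ^a_b(d/dx)`. -/
def mcForm {n : ℕ} (e : ℝ → MobiusGroup n) (x : ℝ) :
    Matrix (Fin (n + 2)) (Fin (n + 2)) ℝ :=
  ((e x).1)⁻¹ * Matrix.of fun i j => deriv (fun y => (e y).1 i j) x

/-- `e : U → Möb(n)` is a zeroth order frame along `f`. -/
structure IsZerothOrderFrame {n : ℕ} (f : ℝ → DarbouxQuadric n) (U : Set ℝ)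
    (e : ℝ → MobiusGroup n) : Prop where
  smooth : ∀ i j, ContDiffOn ℝ ∞ (fun x => (e x).1 i j) U
  proj_eq : ∀ x ∈ U, (e x).proj = f x

/-- First order frames: `φ^α_0 = 0`. They are oriented along the curve, that is, `φ^1_0` is a
positive multiple of `dx`; so two of them differ by a transformation that is the identity on the
tangent direction up to a positive factor. -/
structure IsFirstOrderFrame {n : ℕ} (f : ℝ → DarbouxQuadric n) (U : Set ℝ)
    (e : ℝ → MobiusGroup n) : Prop extends IsZerothOrderFrame f U e where
  phi_normal_zero : ∀ x ∈ U, ∀ α : NormalIndex n, mcForm e x α 0 = 0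
  oriented : ∀ x ∈ U, 0 < mcForm e x 1 0

/-- Second order (Darboux) frames: `φ^α_0 = 0` and `φ^α_1 = 0`. -/
structure IsSecondOrderFrame {n : ℕ} (f : ℝ → DarbouxQuadric n) (U : Set ℝ)
    (e : ℝ → MobiusGroup n) : Prop extends IsFirstOrderFrame f U e where
  phi_normal_one : ∀ x ∈ U, ∀ α : NormalIndex n, mcForm e x α 1 = 0

/-- The coefficients `p^α` given by `φ^0_α = p^α φ^1_0`. -/
def pCoeff {n : ℕ} (e : ℝ → MobiusGroup n) (x : ℝ) (α : NormalIndex n) : ℝ :=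
  mcForm e x 0 α / mcForm e x 1 0

/-- `q` is a `1`-generic point of `f`: `∑_α (p^α)^2 ≠ 0` at `q`, with respect to a Darboux frame
defined around `q`. -/
def IsOneGenericAt {n : ℕ} (f : ℝ → DarbouxQuadric n) (q : ℝ) : Prop :=
  ∃ (V : Set ℝ) (e : ℝ → MobiusGroup n), IsOpen V ∧ q ∈ V ∧ IsSecondOrderFrame f V e ∧
    ∑ α : NormalIndex n, pCoeff e q α ^ 2 ≠ 0

/-- `f : I → Q_n` is a `1`-generic immersion. -/
def IsOneGenericImmersionOn {n : ℕ} (f : ℝ → DarbouxQuadric n) (I : Set ℝ) : Prop :=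
  IsSmoothImmersionOn f I ∧ ∀ q ∈ I, IsOneGenericAt f q

/-- Third order frames: Darboux frames with `φ^0_2 = φ^1_0` and `φ^0_3 = ⋯ = φ^0_n = 0`. -/
structure IsThirdOrderFrame {n : ℕ} (f : ℝ → DarbouxQuadric n) (U : Set ℝ)
    (e : ℝ → MobiusGroup n) : Prop extends IsSecondOrderFrame f U e where
  phi_zero_two : ∀ x ∈ U, mcForm e x 0 2 = mcForm e x 1 0
  phi_zero_b : ∀ x ∈ U, ∀ b : NormalIndex n, 3 ≤ (b.1 : ℕ) → mcForm e x 0 b = 0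

/-- Special third order frames: third order frames with `φ^0_0 = 0`. -/
structure IsSpecialThirdOrderFrame {n : ℕ} (f : ℝ → DarbouxQuadric n) (U : Set ℝ)
    (e : ℝ → MobiusGroup n) : Prop extends IsThirdOrderFrame f U e where
  phi_zero_zero : ∀ x ∈ U, mcForm e x 0 0 = 0

/-- `v : I × (-ε, ε) → Q_n` is an admissible variation of `f` with support in the compact set
`K ⊆ I`; the curve `f_t` is `v(·, t)`. Every `f_t` is a `1`-generic immersion. -/
structure IsAdmissibleVariation {n : ℕ} (f : ℝ → DarbouxQuadric n) (I : Set ℝ) (ε : ℝ)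
    (K : Set ℝ) (v : ℝ → ℝ → DarbouxQuadric n) : Prop where
  isCompact : IsCompact K
  subset : K ⊆ I
  smooth : ContDiffOn ℝ ∞ (fun z : ℝ × ℝ => (v z.1 z.2).coord) (I ×ˢ Set.Ioo (-ε) ε)
  generic : ∀ t ∈ Set.Ioo (-ε) ε, IsOneGenericImmersionOn (fun x => v x t) I
  initial : ∀ x ∈ I, v x 0 = f x
  eq_outside : ∀ x ∈ I \ K, ∀ t ∈ Set.Ioo (-ε) ε, v x t = f x

/-- `e : U × (-ε, ε) → Möb(n)` is a special third order frame along the variation `v` with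
support in `K`. -/
structure IsSpecialThirdOrderFrameAlong {n : ℕ} (ε : ℝ) (K : Set ℝ)
    (v : ℝ → ℝ → DarbouxQuadric n) (U : Set ℝ) (e : ℝ → ℝ → MobiusGroup n) : Prop where
  smooth : ∀ i j, ContDiffOn ℝ ∞ (fun z : ℝ × ℝ => (e z.1 z.2).1 i j) (U ×ˢ Set.Ioo (-ε) ε)
  proj_eq : ∀ x ∈ U, ∀ t ∈ Set.Ioo (-ε) ε, (e x t).proj = v x t
  eq_outside : ∀ x ∈ U \ K, ∀ t ∈ Set.Ioo (-ε) ε, e x t = e x 0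
  special : ∀ t ∈ Set.Ioo (-ε) ε, IsSpecialThirdOrderFrame (fun x => v x t) U (fun x => e x t)

/-- The `dt`-coefficient `Λ(x, t) = e⁻¹ ∂e/∂t` in `φ = φ(t) + Λ dt`. -/
def dtCoeff {n : ℕ} (e : ℝ → ℝ → MobiusGroup n) (x t : ℝ) :
    Matrix (Fin (n + 2)) (Fin (n + 2)) ℝ :=
  mcForm (fun s => e x s) t

/-- The variation coefficients `λ^α_0 = Λ^α_0`. -/
def variationCoeff {n : ℕ} (e : ℝ → ℝ → MobiusGroup n) (α : NormalIndex n) (x t : ℝ) : ℝ :=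
  dtCoeff e x t α 0

end

end ConformalCurves

namespace ConformalCurves

noncomputable section

/-! ### The Lorentzian product -/

/-! The idea is to vary the null lift rather than the frame, and to let each lift determine its own
frame. Let `g` be a lift of the curve to the null cone, with speed `s` and unit tangent `T`. Then
`T' = k g + s N` with `N` null, `⟨g, N⟩ = -1` and `N ⊥ T`, and `N' = k T + D` with `D` normal to
`g`, `T`, `N`. The components of `D` along the normal columns of a second order frame are the
`φ^0_α`, so 1-genericity means `D ≠ 0`. Rescaling the lift by `r` changes `φ^1_0` to `r s` and the
length of `D` to `|D| / r`. The choice `r^2 = |D| / s` makes them equal, and the matching change of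
`T` and `N` gives `φ^0_0 = 0`. Thus the columns 0, 1, 2 and n+1 of a special third order frame are
explicit smooth functions of the derivatives of any lift (`IsRegularLift.gram`,
`isSpecialThirdOrderFrame_of_cols`), and a special third order frame is reproduced by its own first
column (`IsSpecialThirdOrderFrame.frenet`).

The other columns only have to complete these four. A smooth reference family in the Möbius group is
corrected by products of two reflections, which depend smoothly on the data, stay in the identity
component, and are trivial wherever the reference is already correct (`exists_steer`,
`exists_completion`).

For a special frame `e` along `f`, the varied lift is `e_0 + t ∑ λ^α e_α + (t^2/2) |λ|^2 e_{n+1}`,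
where the last term keeps it null. It equals `e_0` at `t = 0` and off `C`, so its normalized frame,
steered from `e`, equals `e` there. Compactness of `C` gives one `ε` for all of `U`. The ratio of
the products of the lift with `e_α` and with `-e_{n+1}` is `t λ^α`. Normalization does not change
this ratio, so its derivative at `t = 0` is the prescribed coefficient (`variationCoeff_eq`). -/

/-- Column vectors of size `n + 2`. -/
abbrev Vec (n : ℕ) : Type := Fin (n + 2) → ℝ

/-- The standard basis vector `η_i`. -/
abbrev stdVec {n : ℕ} (i : Fin (n + 2)) : Vec n := Pi.single i 1

/-- The Lorentzian product. -/
def lorentzProd {n : ℕ} (x y : Vec n) : ℝ := x ⬝ᵥ (lorentzMatrix n *ᵥ y)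

section Product

variable {n : ℕ}

theorem lorentzMatrix_transpose : (lorentzMatrix n)ᵀ = lorentzMatrix n := by
  ext i j
  simp only [Matrix.transpose_apply, lorentzMatrix, Matrix.of_apply]
  have h : ((j = 0 ∧ i = Fin.last (n + 1)) ∨ (j = Fin.last (n + 1) ∧ i = 0)) ↔
      ((i = 0 ∧ j = Fin.last (n + 1)) ∨ (i = Fin.last (n + 1) ∧ j = 0)) := by tauto
  have h' : (j = i ∧ j ≠ 0 ∧ j ≠ Fin.last (n + 1)) ↔
      (i = j ∧ i ≠ 0 ∧ i ≠ Fin.last (n + 1)) := by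
    constructor <;> (rintro ⟨rfl, h2⟩; exact ⟨rfl, h2⟩)
  simp only [h, h']

theorem lorentzProd_comm (x y : Vec n) : lorentzProd x y = lorentzProd y x := by
  rw [lorentzProd, Matrix.dotProduct_mulVec, ← Matrix.mulVec_transpose, lorentzMatrix_transpose,
    dotProduct_comm, lorentzProd]

theorem lorentzProd_self (x : Vec n) : lorentzProd x x = lorentzForm n x := rfl

@[simp] theorem lorentzProd_add_left (x y z : Vec n) :
    lorentzProd (x + y) z = lorentzProd x z + lorentzProd y z := by
  simp [lorentzProd, add_dotProduct]

@[simp] theorem lorentzProd_add_right (x y z : Vec n) :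
    lorentzProd x (y + z) = lorentzProd x y + lorentzProd x z := by
  simp [lorentzProd, Matrix.mulVec_add]

@[simp] theorem lorentzProd_smul_left (a : ℝ) (x y : Vec n) :
    lorentzProd (a • x) y = a * lorentzProd x y := by
  simp [lorentzProd]

@[simp] theorem lorentzProd_smul_right (a : ℝ) (x y : Vec n) :
    lorentzProd x (a • y) = a * lorentzProd x y := by
  simp [lorentzProd, Matrix.mulVec_smul]

@[simp] theorem lorentzProd_neg_left (x y : Vec n) :
    lorentzProd (-x) y = -lorentzProd x y := by
  simp [lorentzProd]

@[simp] theorem lorentzProd_neg_right (x y : Vec n) :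
    lorentzProd x (-y) = -lorentzProd x y := by
  simp [lorentzProd, Matrix.mulVec_neg]

@[simp] theorem lorentzProd_sub_left (x y z : Vec n) :
    lorentzProd (x - y) z = lorentzProd x z - lorentzProd y z := by
  simp [lorentzProd, sub_dotProduct]

@[simp] theorem lorentzProd_sub_right (x y z : Vec n) :
    lorentzProd x (y - z) = lorentzProd x y - lorentzProd x z := by
  simp [lorentzProd, Matrix.mulVec_sub]

@[simp] theorem lorentzProd_zero_right (x : Vec n) : lorentzProd x 0 = 0 := by
  simp [lorentzProd]

@[simp] theorem lorentzProd_zero_left (x : Vec n) : lorentzProd 0 x = 0 := by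
  simp [lorentzProd]

theorem lorentzProd_sum_right {ι : Type*} (s : Finset ι) (x : Vec n) (y : ι → Vec n) :
    lorentzProd x (∑ i ∈ s, y i) = ∑ i ∈ s, lorentzProd x (y i) := by
  simp [lorentzProd, Matrix.mulVec_sum, dotProduct_sum]

theorem lorentzProd_sum_left {ι : Type*} (s : Finset ι) (x : ι → Vec n) (y : Vec n) :
    lorentzProd (∑ i ∈ s, x i) y = ∑ i ∈ s, lorentzProd (x i) y := by
  simp [lorentzProd, sum_dotProduct]

theorem last_ne_zero' : (Fin.last (n + 1)) ≠ 0 := (Fin.last_pos).ne'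

theorem lorentzMatrix_mulVec_zero (y : Vec n) :
    (lorentzMatrix n *ᵥ y) 0 = -y (Fin.last (n + 1)) := by
  have h : ∀ j : Fin (n + 2), lorentzMatrix n 0 j = if j = Fin.last (n + 1) then -1 else 0 := by
    intro j
    simp [lorentzMatrix]
  simp [Matrix.mulVec, dotProduct, h]

theorem lorentzMatrix_mulVec_last (y : Vec n) :
    (lorentzMatrix n *ᵥ y) (Fin.last (n + 1)) = -y 0 := by
  have h : ∀ j : Fin (n + 2), lorentzMatrix n (Fin.last (n + 1)) j = if j = 0 then -1 else 0 := by
    intro j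
    simp [lorentzMatrix]
  simp [Matrix.mulVec, dotProduct, h]

theorem lorentzMatrix_mulVec_of_ne {i : Fin (n + 2)} (h0 : i ≠ 0) (hl : i ≠ Fin.last (n + 1))
    (y : Vec n) : (lorentzMatrix n *ᵥ y) i = y i := by
  have h : ∀ j : Fin (n + 2), lorentzMatrix n i j = if i = j then 1 else 0 := by
    intro j
    simp [lorentzMatrix, h0, hl]
  simp [Matrix.mulVec, dotProduct, h]

@[simp] theorem lorentzProd_stdVec_zero (y : Vec n) :
    lorentzProd (stdVec 0) y = -y (Fin.last (n + 1)) := by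
  simp [lorentzProd, lorentzMatrix_mulVec_zero]

@[simp] theorem lorentzProd_stdVec_last (y : Vec n) :
    lorentzProd (stdVec (Fin.last (n + 1))) y = -y 0 := by
  simp [lorentzProd, lorentzMatrix_mulVec_last]

theorem lorentzProd_stdVec_of_ne {i : Fin (n + 2)} (h0 : i ≠ 0) (hl : i ≠ Fin.last (n + 1))
    (y : Vec n) : lorentzProd (stdVec i) y = y i := by
  simp [lorentzProd, lorentzMatrix_mulVec_of_ne h0 hl]

theorem lorentzMatrix_mul_self : lorentzMatrix n * lorentzMatrix n = 1 := by
  apply Matrix.mulVec_injective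
  funext y
  rw [← Matrix.mulVec_mulVec, Matrix.one_mulVec]
  funext i
  by_cases h0 : i = 0
  · subst h0
    rw [lorentzMatrix_mulVec_zero, lorentzMatrix_mulVec_last, neg_neg]
  by_cases hl : i = Fin.last (n + 1)
  · subst hl
    rw [lorentzMatrix_mulVec_last, lorentzMatrix_mulVec_zero, neg_neg]
  · rw [lorentzMatrix_mulVec_of_ne h0 hl, lorentzMatrix_mulVec_of_ne h0 hl]

/-! ### The Lorentz group -/

theorem lorentzProd_mulVec_mulVec (G : Matrix (Fin (n + 2)) (Fin (n + 2)) ℝ) (x y : Vec n) :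
    lorentzProd (G *ᵥ x) (G *ᵥ y) = x ⬝ᵥ ((Gᵀ * lorentzMatrix n * G) *ᵥ y) := by
  rw [lorentzProd, ← Matrix.mulVec_mulVec, ← Matrix.mulVec_mulVec, dotProduct_comm (G *ᵥ x),
    Matrix.dotProduct_mulVec, ← Matrix.mulVec_transpose, dotProduct_comm]

theorem lorentzProd_mulVec {G : Matrix (Fin (n + 2)) (Fin (n + 2)) ℝ} (hG : G ∈ lorentzGroup n)
    (x y : Vec n) : lorentzProd (G *ᵥ x) (G *ᵥ y) = lorentzProd x y := by
  rw [lorentzProd_mulVec_mulVec, hG, lorentzProd]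

theorem mem_lorentzGroup_of_lorentzProd {G : Matrix (Fin (n + 2)) (Fin (n + 2)) ℝ}
    (hG : ∀ x y : Vec n, lorentzProd (G *ᵥ x) (G *ᵥ y) = lorentzProd x y) :
    G ∈ lorentzGroup n := by
  apply Matrix.mulVec_injective
  funext y
  apply dotProduct_eq
  intro x
  rw [dotProduct_comm, ← lorentzProd_mulVec_mulVec, hG, lorentzProd, dotProduct_comm]

theorem mul_mem_lorentzGroup {G H : Matrix (Fin (n + 2)) (Fin (n + 2)) ℝ}
    (hG : G ∈ lorentzGroup n) (hH : H ∈ lorentzGroup n) : G * H ∈ lorentzGroup n := by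
  apply mem_lorentzGroup_of_lorentzProd
  intro x y
  rw [← Matrix.mulVec_mulVec, ← Matrix.mulVec_mulVec, lorentzProd_mulVec hG,
    lorentzProd_mulVec hH]

theorem one_mem_lorentzGroup : (1 : Matrix (Fin (n + 2)) (Fin (n + 2)) ℝ) ∈ lorentzGroup n := by
  simp [lorentzGroup]

/-- The identity component of the Lorentz group. -/
abbrev mobiusSet (n : ℕ) : Set (Matrix (Fin (n + 2)) (Fin (n + 2)) ℝ) :=
  connectedComponentIn (lorentzGroup n) 1

theorem one_mem_mobiusSet : (1 : Matrix (Fin (n + 2)) (Fin (n + 2)) ℝ) ∈ mobiusSet n :=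
  mem_connectedComponentIn one_mem_lorentzGroup

theorem mem_lorentzGroup_of_mem_mobiusSet {G : Matrix (Fin (n + 2)) (Fin (n + 2)) ℝ}
    (hG : G ∈ mobiusSet n) : G ∈ lorentzGroup n :=
  connectedComponentIn_subset _ _ hG

/-- The left translate of the component by `G` is connected and contains `G`, so it lies in the
component of `G`, which is that of the identity. -/
theorem mul_mem_mobiusSet {G H : Matrix (Fin (n + 2)) (Fin (n + 2)) ℝ}
    (hG : G ∈ mobiusSet n) (hH : H ∈ mobiusSet n) : G * H ∈ mobiusSet n := by
  have hpre : IsPreconnected ((fun X => G * X) '' mobiusSet n) :=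
    isPreconnected_connectedComponentIn.image _ (by fun_prop)
  have hmem : G ∈ (fun X => G * X) '' mobiusSet n := ⟨1, one_mem_mobiusSet, by simp⟩
  have hsub : (fun X => G * X) '' mobiusSet n ⊆ lorentzGroup n := by
    rintro _ ⟨X, hX, rfl⟩
    exact mul_mem_lorentzGroup (mem_lorentzGroup_of_mem_mobiusSet hG)
      (mem_lorentzGroup_of_mem_mobiusSet hX)
  have h := hpre.subset_connectedComponentIn hmem hsub
  rw [mobiusSet, connectedComponentIn_eq hG]
  exact h ⟨H, hH, rfl⟩

/-- A matrix joined to the identity by a path in the Lorentz group is in the identity component. -/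
theorem mem_mobiusSet_of_path (γ : ℝ → Matrix (Fin (n + 2)) (Fin (n + 2)) ℝ)
    (hγ : ContinuousOn γ (Set.Icc 0 1)) (h0 : γ 0 = 1)
    (hmem : ∀ τ ∈ Set.Icc (0 : ℝ) 1, γ τ ∈ lorentzGroup n) : γ 1 ∈ mobiusSet n := by
  have hpre : IsPreconnected (γ '' Set.Icc 0 1) := isPreconnected_Icc.image _ hγ
  exact hpre.subset_connectedComponentIn ⟨0, by simp, h0⟩
    (by rintro _ ⟨τ, hτ, rfl⟩; exact hmem τ hτ) ⟨1, by simp, rfl⟩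

/-! ### Reflections -/

/-- The matrix of the reflection along `v`. -/
def reflMatrix (v : Vec n) : Matrix (Fin (n + 2)) (Fin (n + 2)) ℝ :=
  1 - (2 / lorentzProd v v) • Matrix.vecMulVec v (lorentzMatrix n *ᵥ v)

theorem reflMatrix_mulVec (v x : Vec n) :
    reflMatrix v *ᵥ x = x - (2 * lorentzProd v x / lorentzProd v v) • v := by
  rw [reflMatrix, Matrix.sub_mulVec, Matrix.one_mulVec, Matrix.smul_mulVec,
    Matrix.vecMulVec_mulVec]
  have h : (lorentzMatrix n *ᵥ v) ⬝ᵥ x = lorentzProd v x := by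
    rw [lorentzProd_comm, lorentzProd, dotProduct_comm]
  funext i
  simp [h]
  ring

theorem reflMatrix_mem {v : Vec n} (hv : lorentzProd v v ≠ 0) :
    reflMatrix v ∈ lorentzGroup n := by
  apply mem_lorentzGroup_of_lorentzProd
  intro x y
  simp only [reflMatrix_mulVec, lorentzProd_sub_left, lorentzProd_sub_right,
    lorentzProd_smul_left, lorentzProd_smul_right]
  rw [lorentzProd_comm x v]
  field_simp
  ring

theorem reflMatrix_mul_self {v : Vec n} (hv : lorentzProd v v ≠ 0) :
    reflMatrix v * reflMatrix v = 1 := by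
  apply Matrix.mulVec_injective
  funext x
  rw [← Matrix.mulVec_mulVec, Matrix.one_mulVec]
  simp only [reflMatrix_mulVec, lorentzProd_sub_right, lorentzProd_smul_right]
  have : 2 * (lorentzProd v x - 2 * lorentzProd v x / lorentzProd v v * lorentzProd v v) /
      lorentzProd v v = -(2 * lorentzProd v x / lorentzProd v v) := by
    field_simp
    ring
  rw [this]
  module

theorem reflMatrix_smul {a : ℝ} (ha : a ≠ 0) (v : Vec n) : reflMatrix (a • v) = reflMatrix v := by
  apply Matrix.mulVec_injective
  funext x
  simp only [reflMatrix_mulVec, lorentzProd_smul_left, lorentzProd_smul_right, smul_smul]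
  congr 2
  by_cases hv : lorentzProd v v = 0
  · simp [hv]
  · field_simp

/-- The Lorentz transformation that moves `a` to `b` in the plane spanned by `a` and `b`, where
`a` and `b` have the same nonzero square. -/
def moveMatrix (a b : Vec n) : Matrix (Fin (n + 2)) (Fin (n + 2)) ℝ :=
  reflMatrix (a + b) * reflMatrix a

theorem moveMatrix_mulVec (a b x : Vec n) :
    moveMatrix a b *ᵥ x = reflMatrix (a + b) *ᵥ (reflMatrix a *ᵥ x) := by
  rw [moveMatrix, Matrix.mulVec_mulVec]

theorem moveMatrix_self {a : Vec n} (ha : lorentzProd a a ≠ 0) : moveMatrix a a = 1 := by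
  rw [moveMatrix, ← two_smul ℝ a, reflMatrix_smul two_ne_zero, reflMatrix_mul_self ha]

theorem lorentzProd_add_self (a b : Vec n) : lorentzProd (a + b) (a + b) =
    lorentzProd a a + 2 * lorentzProd a b + lorentzProd b b := by
  simp [lorentzProd_comm b a]
  ring

/-- The first reflection sends `a` to `-a`. The second, along `a + b`, sends `-a` to `b` because `a`
and `b` have equal squares. -/
theorem moveMatrix_apply_left {a b : Vec n} (hab : lorentzProd b b = lorentzProd a a)
    (ha : lorentzProd a a ≠ 0) (h : lorentzProd a b + lorentzProd a a ≠ 0) :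
    moveMatrix a b *ᵥ a = b := by
  have h1 : reflMatrix a *ᵥ a = -a := by
    rw [reflMatrix_mulVec]
    field_simp
    module
  have h2 : lorentzProd (a + b) (a + b) = 2 * (lorentzProd a b + lorentzProd a a) := by
    rw [lorentzProd_add_self, hab]
    ring
  rw [moveMatrix_mulVec, h1, reflMatrix_mulVec, h2]
  have h3 : 2 * lorentzProd (a + b) (-a) / (2 * (lorentzProd a b + lorentzProd a a)) = -1 := by
    simp only [lorentzProd_neg_right, lorentzProd_add_left]
    rw [lorentzProd_comm b a]
    field_simp
    ring
  rw [h3]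
  module

theorem moveMatrix_apply_of_orthogonal {a b x : Vec n} (ha : lorentzProd a x = 0)
    (hb : lorentzProd b x = 0) : moveMatrix a b *ᵥ x = x := by
  rw [moveMatrix_mulVec, reflMatrix_mulVec a, ha]
  simp [reflMatrix_mulVec, ha, hb]

/-- Sliding the axis of the second reflection from `2a` to `a + b` gives a path from the identity to
the move. The inequality keeps the axis away from the null cone. -/
theorem moveMatrix_mem {a b : Vec n} (hab : lorentzProd b b = lorentzProd a a)
    (ha : lorentzProd a a ≠ 0)
    (h : 0 < lorentzProd a a * (lorentzProd a b + lorentzProd a a)) :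
    moveMatrix a b ∈ mobiusSet n := by
  set w : ℝ → Vec n := fun τ => (2 - τ) • a + τ • b with hw
  have hnorm : ∀ τ, lorentzProd (w τ) (w τ) =
      4 * (1 - τ) * lorentzProd a a + 2 * τ ^ 2 * lorentzProd a a - 2 * τ ^ 2 * lorentzProd a b
       + 4 * τ * lorentzProd a b := by
    intro τ
    simp only [hw, lorentzProd_add_left, lorentzProd_add_right, lorentzProd_smul_left,
      lorentzProd_smul_right, hab, lorentzProd_comm b a]
    ring
  have hne : ∀ τ ∈ Set.Icc (0 : ℝ) 1, lorentzProd (w τ) (w τ) ≠ 0 := by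
    rintro τ ⟨h0, h1⟩ hz
    rw [hnorm] at hz
    have hk : 0 < lorentzProd a a ^ 2 := by positivity
    -- The factor `⟨a, a⟩` treats timelike and spacelike `a` at once: both summands are nonnegative.
    -- The first vanishes only at `τ = 1`, where the second is positive.
    have e : lorentzProd a a * (4 * (1 - τ) * lorentzProd a a + 2 * τ ^ 2 * lorentzProd a a
        - 2 * τ ^ 2 * lorentzProd a b + 4 * τ * lorentzProd a b) =
        4 * (1 - τ) ^ 2 * lorentzProd a a ^ 2 + 2 * τ * (2 - τ) *
          (lorentzProd a a * (lorentzProd a b + lorentzProd a a)) := by ring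
    rw [hz, mul_zero] at e
    have p1 : 0 ≤ 4 * (1 - τ) ^ 2 * lorentzProd a a ^ 2 := by positivity
    have p2 : 0 ≤ 2 * τ * (2 - τ) *
          (lorentzProd a a * (lorentzProd a b + lorentzProd a a)) :=
      mul_nonneg (mul_nonneg (by linarith) (by linarith)) h.le
    have p3 : 4 * (1 - τ) ^ 2 * lorentzProd a a ^ 2 = 0 := by linarith
    have p4 : τ = 1 := by
      have : (1 - τ) ^ 2 = 0 := by
        rcases mul_eq_zero.1 p3 with h | h
        · linarith
        · exact absurd h hk.ne'
      nlinarith [pow_eq_zero_iff (two_ne_zero) |>.1 this]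
    subst p4
    linarith
  have h1 : moveMatrix a b = reflMatrix (w 1) * reflMatrix a := by
    rw [moveMatrix, hw]
    congr 2
    module
  rw [h1]
  refine mem_mobiusSet_of_path (fun τ => reflMatrix (w τ) * reflMatrix a) ?_ ?_ ?_
  · refine ContinuousOn.mul ?_ continuousOn_const
    have hwc : Continuous w := by fun_prop
    have hq : Continuous fun τ => lorentzProd (w τ) (w τ) := by
      simp only [hnorm]
      fun_prop
    unfold reflMatrix
    have h2 : ContinuousOn (fun τ => 2 / lorentzProd (w τ) (w τ)) (Set.Icc 0 1) :=
      continuousOn_const.div hq.continuousOn hne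
    have h3 : Continuous fun τ => Matrix.vecMulVec (w τ) (lorentzMatrix n *ᵥ w τ) :=
      Continuous.matrix_vecMulVec hwc (Continuous.matrix_mulVec continuous_const hwc)
    exact continuousOn_const.sub (h2.smul h3.continuousOn)
  · have : w 0 = (2 : ℝ) • a := by
      rw [hw]
      module
    simp only [this, reflMatrix_smul two_ne_zero, reflMatrix_mul_self ha]
  · intro τ hτ
    exact mul_mem_lorentzGroup (reflMatrix_mem (hne τ hτ)) (reflMatrix_mem ha)

end Product

/-! ### Calculus of vector functions -/

section Calculus

variable {n : ℕ}

/-- The Lorentzian product as a continuous bilinear map. -/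
def lorentzCLM (n : ℕ) : Vec n →L[ℝ] Vec n →L[ℝ] ℝ :=
  (LinearMap.mk₂ ℝ (fun x y : Vec n => lorentzProd x y) lorentzProd_add_left
    lorentzProd_smul_left lorentzProd_add_right lorentzProd_smul_right).toContinuousBilinearMap

theorem lorentzCLM_apply (x y : Vec n) : lorentzCLM n x y = lorentzProd x y := rfl

theorem hasDerivAt_lorentzProd {a b : ℝ → Vec n} {a' b' : Vec n} {x : ℝ}
    (ha : HasDerivAt a a' x) (hb : HasDerivAt b b' x) :
    HasDerivAt (fun y => lorentzProd (a y) (b y))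
      (lorentzProd a' (b x) + lorentzProd (a x) b') x := by
  have h := (lorentzCLM n).hasFDerivAt_of_bilinear ha.hasFDerivAt hb.hasFDerivAt
  refine (h.hasDerivAt : HasDerivAt (fun y => lorentzProd (a y) (b y)) _ x).congr_deriv ?_
  have h1 : (lorentzCLM n).precompR ℝ (a x) (ContinuousLinearMap.toSpanSingleton ℝ b') 1 =
      lorentzProd (a x) b' := by
    simp [ContinuousLinearMap.precompR_apply, lorentzCLM_apply]
  have h2 : (lorentzCLM n).precompL ℝ (ContinuousLinearMap.toSpanSingleton ℝ a') (b x) 1 =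
      lorentzProd a' (b x) := by
    simp [ContinuousLinearMap.precompL_apply, lorentzCLM_apply]
  rw [_root_.add_apply, h1, h2, add_comm]

/-- Differentiating a constant product. -/
theorem lorentzProd_deriv_of_const {a b : ℝ → Vec n} {V : Set ℝ} (hV : IsOpen V) {c x : ℝ}
    (hx : x ∈ V) (hc : ∀ y ∈ V, lorentzProd (a y) (b y) = c) (ha : DifferentiableAt ℝ a x)
    (hb : DifferentiableAt ℝ b x) :
    lorentzProd (a x) (deriv b x) = -lorentzProd (deriv a x) (b x) := by
  have h1 := hasDerivAt_lorentzProd ha.hasDerivAt hb.hasDerivAt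
  have h2 : HasDerivAt (fun y => lorentzProd (a y) (b y)) 0 x := by
    refine (hasDerivAt_const x c).congr_of_eventuallyEq ?_
    filter_upwards [hV.mem_nhds hx] with y hy using hc y hy
  linarith [h1.unique h2]

theorem ContDiffOn.lorentzProd {E : Type*} [NormedAddCommGroup E] [NormedSpace ℝ E]
    {a b : E → Vec n} {W : Set E} (ha : ContDiffOn ℝ ∞ a W) (hb : ContDiffOn ℝ ∞ b W) :
    ContDiffOn ℝ ∞ (fun z => ConformalCurves.lorentzProd (a z) (b z)) W :=
  ((lorentzCLM n).contDiff.comp_contDiffOn ha).clm_apply hb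

/-- The Frenet vectors use `x`-derivatives at fixed `t`; this keeps each of them jointly smooth in
`(x, t)`. -/
theorem ContDiffOn.partial_fst {F : Type*} [NormedAddCommGroup F] [NormedSpace ℝ F]
    {G : ℝ → ℝ → F} {W : Set (ℝ × ℝ)} (hW : IsOpen W)
    (hG : ContDiffOn ℝ ∞ (fun z : ℝ × ℝ => G z.1 z.2) W) :
    ContDiffOn ℝ ∞ (fun z : ℝ × ℝ => deriv (fun y => G y z.2) z.1) W := by
  have h1 : ContDiffOn ℝ ∞ (fun z => fderiv ℝ (fun z : ℝ × ℝ => G z.1 z.2) z (1, 0)) W :=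
    (hG.fderiv_of_isOpen hW (by simp)).clm_apply contDiffOn_const
  refine h1.congr fun z hz => ?_
  have h2 : HasFDerivAt (fun z : ℝ × ℝ => G z.1 z.2)
      (fderiv ℝ (fun z : ℝ × ℝ => G z.1 z.2) z) (z.1, z.2) :=
    ((hG.contDiffAt (hW.mem_nhds hz)).differentiableAt (by simp)).hasFDerivAt
  have h3 : HasDerivAt (fun y : ℝ => (y, z.2)) ((1 : ℝ), (0 : ℝ)) z.1 :=
    (hasDerivAt_id z.1).prodMk (hasDerivAt_const z.1 z.2)
  exact (h2.comp_hasDerivAt z.1 h3).deriv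

theorem ContDiffOn.slice_fst {F : Type*} [NormedAddCommGroup F] [NormedSpace ℝ F]
    {G : ℝ → ℝ → F} {W : Set (ℝ × ℝ)}
    (hG : ContDiffOn ℝ ∞ (fun z : ℝ × ℝ => G z.1 z.2) W) (t : ℝ) :
    ContDiffOn ℝ ∞ (fun y => G y t) {y | (y, t) ∈ W} :=
  ContDiffOn.comp (t := W) hG (f := fun y : ℝ => (y, t)) (by fun_prop) fun _ h => h

theorem ContDiffOn.prod_const {F : Type*} [NormedAddCommGroup F] [NormedSpace ℝ F]
    {g : ℝ → F} {V : Set ℝ} (hg : ContDiffOn ℝ ∞ g V) :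
    ContDiffOn ℝ ∞ (fun z : ℝ × ℝ => g z.1) (V ×ˢ Set.univ) :=
  hg.comp contDiffOn_fst fun _ h => h.1

theorem isOpen_slice_fst {W : Set (ℝ × ℝ)} (hW : IsOpen W) (t : ℝ) :
    IsOpen {y | (y, t) ∈ W} :=
  hW.preimage (by fun_prop : Continuous fun y : ℝ => (y, t))

theorem ContDiffOn.differentiableAt_of_isOpen {F : Type*} [NormedAddCommGroup F]
    [NormedSpace ℝ F] {g : ℝ → F} {V : Set ℝ} (hV : IsOpen V) (hg : ContDiffOn ℝ ∞ g V) {x : ℝ}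
    (hx : x ∈ V) : DifferentiableAt ℝ g x :=
  (hg.contDiffAt (hV.mem_nhds hx)).differentiableAt (by simp)

end Calculus

/-! ### The Frenet apparatus of a curve of null vectors -/

section Frenet

variable {n : ℕ}

/-- The speed of a lift `g`. -/
def speed (g : ℝ → Vec n) (x : ℝ) : ℝ := √(lorentzProd (deriv g x) (deriv g x))

/-- The unit tangent vector of a lift. -/
def tangent (g : ℝ → Vec n) (x : ℝ) : Vec n := (speed g x)⁻¹ • deriv g x

/-- The coefficient of the lift in the derivative of its unit tangent vector. -/
def liftCurv (g : ℝ → Vec n) (x : ℝ) : ℝ :=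
  -lorentzProd (deriv (tangent g) x) (deriv (tangent g) x) / (2 * speed g x)

/-- The null vector dual to the lift that is orthogonal to the tangent vector. -/
def dualLift (g : ℝ → Vec n) (x : ℝ) : Vec n :=
  (speed g x)⁻¹ • (deriv (tangent g) x - liftCurv g x • g x)

/-- The normal part of the derivative of the dual vector. -/
def dualNormal (g : ℝ → Vec n) (x : ℝ) : Vec n :=
  deriv (dualLift g) x - liftCurv g x • tangent g x

/-- The length of `dualNormal`. -/
def dualLength (g : ℝ → Vec n) (x : ℝ) : ℝ := √(lorentzProd (dualNormal g x) (dualNormal g x))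

/-- The factor that turns a lift into the normalized lift. -/
def liftScale (g : ℝ → Vec n) (x : ℝ) : ℝ := √(dualLength g x / speed g x)

/-- The logarithmic derivative of `liftScale` with respect to arc length. -/
def liftShift (g : ℝ → Vec n) (x : ℝ) : ℝ :=
  deriv (liftScale g) x / (liftScale g x * speed g x)

/-- The normalized lift. -/
def vecZero (g : ℝ → Vec n) (x : ℝ) : Vec n := liftScale g x • g x

/-- The unit tangent vector of the normalized lift. -/
def vecOne (g : ℝ → Vec n) (x : ℝ) : Vec n := tangent g x + liftShift g x • g x

/-- The unit normal vector. -/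
def vecTwo (g : ℝ → Vec n) (x : ℝ) : Vec n := (dualLength g x)⁻¹ • dualNormal g x

/-- The null vector dual to the normalized lift. -/
def vecLast (g : ℝ → Vec n) (x : ℝ) : Vec n :=
  (liftScale g x)⁻¹ •
    (dualLift g x + liftShift g x • tangent g x + (liftShift g x ^ 2 / 2) • g x)

variable {G : ℝ → ℝ → Vec n} {W : Set (ℝ × ℝ)}

theorem contDiffOn_speed (hW : IsOpen W) (hG : ContDiffOn ℝ ∞ (fun z : ℝ × ℝ => G z.1 z.2) W)
    (hs : ∀ z ∈ W, 0 < speed (fun y => G y z.2) z.1) :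
    ContDiffOn ℝ ∞ (fun z : ℝ × ℝ => speed (fun y => G y z.2) z.1) W := by
  have h := ContDiffOn.partial_fst hW hG
  exact (ContDiffOn.lorentzProd h h).sqrt fun z hz => (Real.sqrt_pos.1 (hs z hz)).ne'

theorem contDiffOn_tangent (hW : IsOpen W) (hG : ContDiffOn ℝ ∞ (fun z : ℝ × ℝ => G z.1 z.2) W)
    (hs : ∀ z ∈ W, 0 < speed (fun y => G y z.2) z.1) :
    ContDiffOn ℝ ∞ (fun z : ℝ × ℝ => tangent (fun y => G y z.2) z.1) W :=
  ((contDiffOn_speed hW hG hs).inv fun z hz => (hs z hz).ne').smul (ContDiffOn.partial_fst hW hG)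

theorem contDiffOn_deriv_tangent (hW : IsOpen W)
    (hG : ContDiffOn ℝ ∞ (fun z : ℝ × ℝ => G z.1 z.2) W)
    (hs : ∀ z ∈ W, 0 < speed (fun y => G y z.2) z.1) :
    ContDiffOn ℝ ∞ (fun z : ℝ × ℝ => deriv (tangent (fun y => G y z.2)) z.1) W :=
  ContDiffOn.partial_fst (G := fun x t => tangent (fun y => G y t) x) hW
    (contDiffOn_tangent hW hG hs)

theorem contDiffOn_liftCurv (hW : IsOpen W)
    (hG : ContDiffOn ℝ ∞ (fun z : ℝ × ℝ => G z.1 z.2) W)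
    (hs : ∀ z ∈ W, 0 < speed (fun y => G y z.2) z.1) :
    ContDiffOn ℝ ∞ (fun z : ℝ × ℝ => liftCurv (fun y => G y z.2) z.1) W := by
  have h := contDiffOn_deriv_tangent hW hG hs
  exact (ContDiffOn.lorentzProd h h).neg.div (contDiffOn_const.mul (contDiffOn_speed hW hG hs))
    fun z hz => mul_ne_zero two_ne_zero (hs z hz).ne'

theorem contDiffOn_dualLift (hW : IsOpen W)
    (hG : ContDiffOn ℝ ∞ (fun z : ℝ × ℝ => G z.1 z.2) W)
    (hs : ∀ z ∈ W, 0 < speed (fun y => G y z.2) z.1) :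
    ContDiffOn ℝ ∞ (fun z : ℝ × ℝ => dualLift (fun y => G y z.2) z.1) W :=
  ((contDiffOn_speed hW hG hs).inv fun z hz => (hs z hz).ne').smul
    ((contDiffOn_deriv_tangent hW hG hs).sub ((contDiffOn_liftCurv hW hG hs).smul hG))

theorem contDiffOn_dualNormal (hW : IsOpen W)
    (hG : ContDiffOn ℝ ∞ (fun z : ℝ × ℝ => G z.1 z.2) W)
    (hs : ∀ z ∈ W, 0 < speed (fun y => G y z.2) z.1) :
    ContDiffOn ℝ ∞ (fun z : ℝ × ℝ => dualNormal (fun y => G y z.2) z.1) W :=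
  (ContDiffOn.partial_fst (G := fun x t => dualLift (fun y => G y t) x) hW
    (contDiffOn_dualLift hW hG hs)).sub
    ((contDiffOn_liftCurv hW hG hs).smul (contDiffOn_tangent hW hG hs))

theorem contDiffOn_dualLength (hW : IsOpen W)
    (hG : ContDiffOn ℝ ∞ (fun z : ℝ × ℝ => G z.1 z.2) W)
    (hs : ∀ z ∈ W, 0 < speed (fun y => G y z.2) z.1)
    (hq : ∀ z ∈ W, 0 < dualLength (fun y => G y z.2) z.1) :
    ContDiffOn ℝ ∞ (fun z : ℝ × ℝ => dualLength (fun y => G y z.2) z.1) W := by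
  have h := contDiffOn_dualNormal hW hG hs
  exact (ContDiffOn.lorentzProd h h).sqrt fun z hz => (Real.sqrt_pos.1 (hq z hz)).ne'

theorem liftScale_pos {g : ℝ → Vec n} {x : ℝ} (hs : 0 < speed g x) (hq : 0 < dualLength g x) :
    0 < liftScale g x :=
  Real.sqrt_pos.2 (div_pos hq hs)

theorem contDiffOn_liftScale (hW : IsOpen W)
    (hG : ContDiffOn ℝ ∞ (fun z : ℝ × ℝ => G z.1 z.2) W)
    (hs : ∀ z ∈ W, 0 < speed (fun y => G y z.2) z.1)
    (hq : ∀ z ∈ W, 0 < dualLength (fun y => G y z.2) z.1) :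
    ContDiffOn ℝ ∞ (fun z : ℝ × ℝ => liftScale (fun y => G y z.2) z.1) W :=
  ((contDiffOn_dualLength hW hG hs hq).div (contDiffOn_speed hW hG hs)
    fun z hz => (hs z hz).ne').sqrt fun z hz => (div_pos (hq z hz) (hs z hz)).ne'

theorem contDiffOn_liftShift (hW : IsOpen W)
    (hG : ContDiffOn ℝ ∞ (fun z : ℝ × ℝ => G z.1 z.2) W)
    (hs : ∀ z ∈ W, 0 < speed (fun y => G y z.2) z.1)
    (hq : ∀ z ∈ W, 0 < dualLength (fun y => G y z.2) z.1) :
    ContDiffOn ℝ ∞ (fun z : ℝ × ℝ => liftShift (fun y => G y z.2) z.1) W :=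
  (ContDiffOn.partial_fst (G := fun x t => liftScale (fun y => G y t) x) hW
    (contDiffOn_liftScale hW hG hs hq)).div
    ((contDiffOn_liftScale hW hG hs hq).mul (contDiffOn_speed hW hG hs))
    fun z hz => (mul_pos (liftScale_pos (hs z hz) (hq z hz)) (hs z hz)).ne'

theorem contDiffOn_vecZero (hW : IsOpen W)
    (hG : ContDiffOn ℝ ∞ (fun z : ℝ × ℝ => G z.1 z.2) W)
    (hs : ∀ z ∈ W, 0 < speed (fun y => G y z.2) z.1)
    (hq : ∀ z ∈ W, 0 < dualLength (fun y => G y z.2) z.1) :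
    ContDiffOn ℝ ∞ (fun z : ℝ × ℝ => vecZero (fun y => G y z.2) z.1) W :=
  (contDiffOn_liftScale hW hG hs hq).smul hG

theorem contDiffOn_vecOne (hW : IsOpen W)
    (hG : ContDiffOn ℝ ∞ (fun z : ℝ × ℝ => G z.1 z.2) W)
    (hs : ∀ z ∈ W, 0 < speed (fun y => G y z.2) z.1)
    (hq : ∀ z ∈ W, 0 < dualLength (fun y => G y z.2) z.1) :
    ContDiffOn ℝ ∞ (fun z : ℝ × ℝ => vecOne (fun y => G y z.2) z.1) W :=
  (contDiffOn_tangent hW hG hs).add ((contDiffOn_liftShift hW hG hs hq).smul hG)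

theorem contDiffOn_vecTwo (hW : IsOpen W)
    (hG : ContDiffOn ℝ ∞ (fun z : ℝ × ℝ => G z.1 z.2) W)
    (hs : ∀ z ∈ W, 0 < speed (fun y => G y z.2) z.1)
    (hq : ∀ z ∈ W, 0 < dualLength (fun y => G y z.2) z.1) :
    ContDiffOn ℝ ∞ (fun z : ℝ × ℝ => vecTwo (fun y => G y z.2) z.1) W :=
  ((contDiffOn_dualLength hW hG hs hq).inv fun z hz => (hq z hz).ne').smul
    (contDiffOn_dualNormal hW hG hs)

theorem contDiffOn_vecLast (hW : IsOpen W)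
    (hG : ContDiffOn ℝ ∞ (fun z : ℝ × ℝ => G z.1 z.2) W)
    (hs : ∀ z ∈ W, 0 < speed (fun y => G y z.2) z.1)
    (hq : ∀ z ∈ W, 0 < dualLength (fun y => G y z.2) z.1) :
    ContDiffOn ℝ ∞ (fun z : ℝ × ℝ => vecLast (fun y => G y z.2) z.1) W := by
  have hy := contDiffOn_liftShift hW hG hs hq
  exact ((contDiffOn_liftScale hW hG hs hq).inv
    fun z hz => (liftScale_pos (hs z hz) (hq z hz)).ne').smul
    (((contDiffOn_dualLift hW hG hs).add (hy.smul (contDiffOn_tangent hW hG hs))).add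
      (((hy.pow 2).div_const 2).smul hG))

/-! The orthogonality relations. -/

/-- `g` is a smooth lift to the null cone, of positive speed, on the open set `V`. -/
structure IsRegularLift (g : ℝ → Vec n) (V : Set ℝ) : Prop where
  isOpen : IsOpen V
  smooth : ContDiffOn ℝ ∞ g V
  null : ∀ x ∈ V, lorentzProd (g x) (g x) = 0
  speed_pos : ∀ x ∈ V, 0 < speed g x

variable {g : ℝ → Vec n} {V : Set ℝ} {x : ℝ}

/-- One-variable smoothness is obtained from the two-variable results applied to a family that does
not depend on `t`. -/
theorem ContDiffOn.of_prod_univ {F : Type*} [NormedAddCommGroup F] [NormedSpace ℝ F]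
    {h : ℝ → F} (hh : ContDiffOn ℝ ∞ (fun z : ℝ × ℝ => h z.1) (V ×ˢ Set.univ)) :
    ContDiffOn ℝ ∞ h V := by
  have h1 := ContDiffOn.slice_fst (G := fun y _ => h y) hh 0
  simpa using h1

namespace IsRegularLift

theorem contDiffOn_tangent (h : IsRegularLift g V) : ContDiffOn ℝ ∞ (tangent g) V :=
  ContDiffOn.of_prod_univ (ConformalCurves.contDiffOn_tangent (G := fun y _ => g y)
    (h.isOpen.prod isOpen_univ) (ContDiffOn.prod_const h.smooth) fun _ hz => h.speed_pos _ hz.1)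

theorem contDiffOn_dualLift (h : IsRegularLift g V) : ContDiffOn ℝ ∞ (dualLift g) V :=
  ContDiffOn.of_prod_univ (ConformalCurves.contDiffOn_dualLift (G := fun y _ => g y)
    (h.isOpen.prod isOpen_univ) (ContDiffOn.prod_const h.smooth) fun _ hz => h.speed_pos _ hz.1)

theorem contDiffOn_liftScale (h : IsRegularLift g V) (hq : ∀ x ∈ V, 0 < dualLength g x) :
    ContDiffOn ℝ ∞ (liftScale g) V :=
  ContDiffOn.of_prod_univ (ConformalCurves.contDiffOn_liftScale (G := fun y _ => g y)
    (h.isOpen.prod isOpen_univ) (ContDiffOn.prod_const h.smooth) (fun _ hz => h.speed_pos _ hz.1)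
    fun _ hz => hq _ hz.1)

theorem contDiffOn_liftShift (h : IsRegularLift g V) (hq : ∀ x ∈ V, 0 < dualLength g x) :
    ContDiffOn ℝ ∞ (liftShift g) V :=
  ContDiffOn.of_prod_univ (ConformalCurves.contDiffOn_liftShift (G := fun y _ => g y)
    (h.isOpen.prod isOpen_univ) (ContDiffOn.prod_const h.smooth) (fun _ hz => h.speed_pos _ hz.1)
    fun _ hz => hq _ hz.1)

theorem diff (h : IsRegularLift g V) (hx : x ∈ V) : DifferentiableAt ℝ g x :=
  ContDiffOn.differentiableAt_of_isOpen h.isOpen h.smooth hx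

theorem diff_tangent (h : IsRegularLift g V) (hx : x ∈ V) : DifferentiableAt ℝ (tangent g) x :=
  ContDiffOn.differentiableAt_of_isOpen h.isOpen h.contDiffOn_tangent hx

theorem diff_dualLift (h : IsRegularLift g V) (hx : x ∈ V) : DifferentiableAt ℝ (dualLift g) x :=
  ContDiffOn.differentiableAt_of_isOpen h.isOpen h.contDiffOn_dualLift hx

theorem speed_sq (h : IsRegularLift g V) (hx : x ∈ V) :
    lorentzProd (deriv g x) (deriv g x) = speed g x ^ 2 := by
  rw [speed, Real.sq_sqrt]
  exact (Real.sqrt_pos.1 (h.speed_pos x hx)).le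

theorem deriv_eq (h : IsRegularLift g V) (hx : x ∈ V) : deriv g x = speed g x • tangent g x := by
  rw [tangent, smul_smul, mul_inv_cancel₀ (h.speed_pos x hx).ne', one_smul]

theorem prod_lift_deriv (h : IsRegularLift g V) (hx : x ∈ V) :
    lorentzProd (g x) (deriv g x) = 0 := by
  have h1 := lorentzProd_deriv_of_const h.isOpen hx h.null (h.diff hx) (h.diff hx)
  rw [lorentzProd_comm (deriv g x)] at h1
  linarith

theorem prod_lift_tangent (h : IsRegularLift g V) (hx : x ∈ V) :
    lorentzProd (g x) (tangent g x) = 0 := by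
  rw [tangent, lorentzProd_smul_right, h.prod_lift_deriv hx, mul_zero]

theorem prod_tangent_tangent (h : IsRegularLift g V) (hx : x ∈ V) :
    lorentzProd (tangent g x) (tangent g x) = 1 := by
  have := (h.speed_pos x hx).ne'
  rw [tangent, lorentzProd_smul_right, lorentzProd_smul_left, h.speed_sq hx]
  field_simp

theorem prod_tangent_deriv (h : IsRegularLift g V) (hx : x ∈ V) :
    lorentzProd (tangent g x) (deriv (tangent g) x) = 0 := by
  have h1 := lorentzProd_deriv_of_const h.isOpen hx (fun y hy => h.prod_tangent_tangent hy)
    (h.diff_tangent hx) (h.diff_tangent hx)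
  rw [lorentzProd_comm (deriv _ x)] at h1
  linarith

theorem prod_lift_deriv_tangent (h : IsRegularLift g V) (hx : x ∈ V) :
    lorentzProd (g x) (deriv (tangent g) x) = -speed g x := by
  rw [lorentzProd_deriv_of_const h.isOpen hx (fun y hy => h.prod_lift_tangent hy) (h.diff hx)
    (h.diff_tangent hx), h.deriv_eq hx, lorentzProd_smul_left, h.prod_tangent_tangent hx, mul_one]

theorem deriv_tangent_eq (h : IsRegularLift g V) (hx : x ∈ V) :
    deriv (tangent g) x = liftCurv g x • g x + speed g x • dualLift g x := by
  rw [dualLift, smul_smul, mul_inv_cancel₀ (h.speed_pos x hx).ne']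
  module

theorem prod_lift_dualLift (h : IsRegularLift g V) (hx : x ∈ V) :
    lorentzProd (g x) (dualLift g x) = -1 := by
  have := (h.speed_pos x hx).ne'
  rw [dualLift, lorentzProd_smul_right, lorentzProd_sub_right, lorentzProd_smul_right,
    h.prod_lift_deriv_tangent hx, h.null x hx]
  field_simp
  ring

theorem prod_tangent_dualLift (h : IsRegularLift g V) (hx : x ∈ V) :
    lorentzProd (tangent g x) (dualLift g x) = 0 := by
  rw [dualLift, lorentzProd_smul_right, lorentzProd_sub_right, lorentzProd_smul_right,
    h.prod_tangent_deriv hx, lorentzProd_comm, h.prod_lift_tangent hx]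
  ring

/-- The coefficient `k` in `liftCurv` is chosen for this: `⟨T' - k g, T' - k g⟩ = ⟨T', T'⟩ + 2 k s`,
since `⟨g, T'⟩ = -s`. -/
theorem prod_dualLift_dualLift (h : IsRegularLift g V) (hx : x ∈ V) :
    lorentzProd (dualLift g x) (dualLift g x) = 0 := by
  have := (h.speed_pos x hx).ne'
  simp only [dualLift, lorentzProd_smul_right, lorentzProd_smul_left, lorentzProd_sub_right,
    lorentzProd_sub_left, h.null x hx, h.prod_lift_deriv_tangent hx]
  rw [lorentzProd_comm (deriv (tangent g) x) (g x), h.prod_lift_deriv_tangent hx, liftCurv]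
  field_simp
  ring

theorem deriv_dualLift_eq (g : ℝ → Vec n) (x : ℝ) :
    deriv (dualLift g) x = liftCurv g x • tangent g x + dualNormal g x := by
  rw [dualNormal]
  module

theorem prod_dualLift_dualNormal (h : IsRegularLift g V) (hx : x ∈ V) :
    lorentzProd (dualLift g x) (dualNormal g x) = 0 := by
  have h1 := lorentzProd_deriv_of_const h.isOpen hx (fun y hy => h.prod_dualLift_dualLift hy)
    (h.diff_dualLift hx) (h.diff_dualLift hx)
  rw [lorentzProd_comm (deriv _ x)] at h1
  rw [dualNormal, lorentzProd_sub_right, lorentzProd_smul_right, lorentzProd_comm _ (tangent g x),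
    h.prod_tangent_dualLift hx]
  linarith

theorem prod_lift_dualNormal (h : IsRegularLift g V) (hx : x ∈ V) :
    lorentzProd (g x) (dualNormal g x) = 0 := by
  have h1 := lorentzProd_deriv_of_const h.isOpen hx (fun y hy => h.prod_lift_dualLift hy)
    (h.diff hx) (h.diff_dualLift hx)
  rw [dualNormal, lorentzProd_sub_right, lorentzProd_smul_right, h.prod_lift_tangent hx, h1,
    h.deriv_eq hx, lorentzProd_smul_left, h.prod_tangent_dualLift hx]
  ring

/-- Skew-symmetry gives `⟨T, N'⟩ = -⟨T', N⟩ = k`, so the same coefficient occurs in `T'` and in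
`N'`. -/
theorem prod_tangent_dualNormal (h : IsRegularLift g V) (hx : x ∈ V) :
    lorentzProd (tangent g x) (dualNormal g x) = 0 := by
  have h1 := lorentzProd_deriv_of_const h.isOpen hx (fun y hy => h.prod_tangent_dualLift hy)
    (h.diff_tangent hx) (h.diff_dualLift hx)
  rw [dualNormal, lorentzProd_sub_right, lorentzProd_smul_right, h.prod_tangent_tangent hx, h1,
    h.deriv_tangent_eq hx, lorentzProd_add_left, lorentzProd_smul_left, lorentzProd_smul_left,
    h.prod_lift_dualLift hx, h.prod_dualLift_dualLift hx]
  ring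

end IsRegularLift

end Frenet

/-! ### Normalization of the lift: rescaling and the induced change of tangent and dual vector. -/

section Normalized

variable {n : ℕ} {g : ℝ → Vec n} {V : Set ℝ} {x : ℝ}

theorem dualLength_sq (hq : 0 < dualLength g x) :
    lorentzProd (dualNormal g x) (dualNormal g x) = dualLength g x ^ 2 := by
  rw [dualLength, Real.sq_sqrt]
  exact (Real.sqrt_pos.1 hq).le

theorem liftScale_sq (hs : 0 < speed g x) (hq : 0 < dualLength g x) :
    liftScale g x ^ 2 * speed g x = dualLength g x := by
  rw [liftScale, Real.sq_sqrt (div_pos hq hs).le]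
  field_simp

namespace IsRegularLift

/-- The products of the vectors of the normalized frame. -/
theorem gram (h : IsRegularLift g V) (hq : ∀ x ∈ V, 0 < dualLength g x) (hx : x ∈ V) :
    lorentzProd (vecZero g x) (vecZero g x) = 0 ∧ lorentzProd (vecZero g x) (vecOne g x) = 0 ∧
    lorentzProd (vecZero g x) (vecTwo g x) = 0 ∧ lorentzProd (vecZero g x) (vecLast g x) = -1 ∧
    lorentzProd (vecOne g x) (vecOne g x) = 1 ∧ lorentzProd (vecOne g x) (vecTwo g x) = 0 ∧
    lorentzProd (vecOne g x) (vecLast g x) = 0 ∧ lorentzProd (vecTwo g x) (vecTwo g x) = 1 ∧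
    lorentzProd (vecTwo g x) (vecLast g x) = 0 ∧ lorentzProd (vecLast g x) (vecLast g x) = 0 := by
  have hr := (liftScale_pos (h.speed_pos x hx) (hq x hx)).ne'
  have hq' := (hq x hx).ne'
  simp only [vecZero, vecOne, vecTwo, vecLast, lorentzProd_smul_left, lorentzProd_smul_right,
    lorentzProd_add_left, lorentzProd_add_right, lorentzProd_comm (tangent g x) (g x),
    lorentzProd_comm (dualLift g x) (g x), lorentzProd_comm (dualNormal g x) (g x),
    lorentzProd_comm (dualLift g x) (tangent g x), lorentzProd_comm (dualNormal g x) (tangent g x),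
    lorentzProd_comm (dualNormal g x) (dualLift g x), h.null x hx, h.prod_lift_tangent hx,
    h.prod_tangent_tangent hx, h.prod_lift_dualLift hx, h.prod_tangent_dualLift hx,
    h.prod_dualLift_dualLift hx, h.prod_lift_dualNormal hx, h.prod_tangent_dualNormal hx,
    h.prod_dualLift_dualNormal hx, dualLength_sq (hq x hx)]
  refine ⟨?_, ?_, ?_, ?_, ?_, ?_, ?_, ?_, ?_, ?_⟩ <;> field_simp <;> ring

/-- The shift `r' / (r s)` moves the term `r' g` into the new tangent vector. No component along the
lift remains, which is the condition `φ^0_0 = 0`. -/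
theorem deriv_vecZero (h : IsRegularLift g V) (hq : ∀ x ∈ V, 0 < dualLength g x) (hx : x ∈ V) :
    deriv (vecZero g) x = (liftScale g x * speed g x) • vecOne g x := by
  have hs := (h.speed_pos x hx).ne'
  have hr := (liftScale_pos (h.speed_pos x hx) (hq x hx)).ne'
  have hd := ContDiffOn.differentiableAt_of_isOpen h.isOpen (h.contDiffOn_liftScale hq) hx
  have h1 : deriv (liftScale g) x = liftScale g x * speed g x * liftShift g x := by
    rw [liftShift]
    field_simp
  have h2 := hd.hasDerivAt.smul (h.diff hx).hasDerivAt
  have h3 : deriv (vecZero g) x = liftScale g x • deriv g x + deriv (liftScale g) x • g x :=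
    h2.deriv
  rw [h3, h1, h.deriv_eq hx, vecOne]
  module

/-- A vector orthogonal to the normalized null and tangent vectors is orthogonal to the
unnormalized ones. -/
theorem prod_eq_zero_of_orthogonal (h : IsRegularLift g V) (hq : ∀ x ∈ V, 0 < dualLength g x)
    (hx : x ∈ V) {a : Vec n} (h0 : lorentzProd a (vecZero g x) = 0)
    (h1 : lorentzProd a (vecOne g x) = 0) (hl : lorentzProd a (vecLast g x) = 0) :
    lorentzProd a (g x) = 0 ∧ lorentzProd a (tangent g x) = 0 ∧
      lorentzProd a (dualLift g x) = 0 := by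
  have hr := (liftScale_pos (h.speed_pos x hx) (hq x hx)).ne'
  have e0 : lorentzProd a (g x) = 0 := by
    rw [vecZero, lorentzProd_smul_right] at h0
    exact (mul_eq_zero.1 h0).resolve_left hr
  have e1 : lorentzProd a (tangent g x) = 0 := by
    rw [vecOne, lorentzProd_add_right, lorentzProd_smul_right, e0] at h1
    linarith
  refine ⟨e0, e1, ?_⟩
  rw [vecLast, lorentzProd_smul_right] at hl
  have := (mul_eq_zero.1 hl).resolve_left (inv_ne_zero hr)
  simpa [e0, e1] using this

/-- The derivative stays in the span of `g`, `T` and `N`. This gives `φ^α_1 = 0`. -/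
theorem prod_deriv_vecOne (h : IsRegularLift g V) (hq : ∀ x ∈ V, 0 < dualLength g x)
    (hx : x ∈ V) {a : Vec n} (h0 : lorentzProd a (vecZero g x) = 0)
    (h1 : lorentzProd a (vecOne g x) = 0) (hl : lorentzProd a (vecLast g x) = 0) :
    lorentzProd a (deriv (vecOne g) x) = 0 := by
  obtain ⟨e0, e1, el⟩ := h.prod_eq_zero_of_orthogonal hq hx h0 h1 hl
  have hd := ContDiffOn.differentiableAt_of_isOpen h.isOpen (h.contDiffOn_liftShift hq) hx
  have h2 := (h.diff_tangent hx).hasDerivAt.add (hd.hasDerivAt.smul (h.diff hx).hasDerivAt)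
  have h3 : deriv (vecOne g) x =
      deriv (tangent g) x + (liftShift g x • deriv g x + deriv (liftShift g) x • g x) := h2.deriv
  rw [h3, h.deriv_tangent_eq hx, h.deriv_eq hx]
  simp [e0, e1, el]

/-- Only the term `r⁻¹ D` of the derivative survives, and `|D| = r^2 s` turns its length into `r s`,
the speed of the normalized lift. This gives `φ^0_2 = φ^1_0` and `φ^0_b = 0`. -/
theorem prod_deriv_vecLast (h : IsRegularLift g V) (hq : ∀ x ∈ V, 0 < dualLength g x)
    (hx : x ∈ V) {a : Vec n} (h0 : lorentzProd a (vecZero g x) = 0)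
    (h1 : lorentzProd a (vecOne g x) = 0) (hl : lorentzProd a (vecLast g x) = 0) :
    lorentzProd a (deriv (vecLast g) x) =
      liftScale g x * speed g x * lorentzProd a (vecTwo g x) := by
  obtain ⟨e0, e1, el⟩ := h.prod_eq_zero_of_orthogonal hq hx h0 h1 hl
  have hs := (h.speed_pos x hx).ne'
  have hr := (liftScale_pos (h.speed_pos x hx) (hq x hx)).ne'
  have hy := (ContDiffOn.differentiableAt_of_isOpen h.isOpen (h.contDiffOn_liftShift hq)
    hx).hasDerivAt
  have hrd := (ContDiffOn.differentiableAt_of_isOpen h.isOpen (h.contDiffOn_liftScale hq)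
    hx).hasDerivAt
  have h2 := (hrd.inv hr).smul (((h.diff_dualLift hx).hasDerivAt.add
    (hy.smul (h.diff_tangent hx).hasDerivAt)).add
    (((hy.pow 2).div_const 2).smul (h.diff hx).hasDerivAt))
  have h3 := h2.deriv
  change deriv (vecLast g) x = _ at h3
  rw [h3, h.deriv_tangent_eq hx, h.deriv_eq hx, deriv_dualLift_eq]
  have hq' := (hq x hx).ne'
  simp only [Pi.add_apply, Pi.smul_apply', Pi.inv_apply, lorentzProd_add_right,
    lorentzProd_smul_right, e0, e1, el, vecTwo]
  have h4 := liftScale_sq (h.speed_pos x hx) (hq x hx)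
  simp only [mul_zero, add_zero, zero_add]
  rw [← h4]
  field_simp

end IsRegularLift

end Normalized

/-! ### The Maurer–Cartan form in terms of the Lorentzian product -/

section MaurerCartan

variable {n : ℕ}

theorem inv_eq_of_mem_lorentzGroup {G : Matrix (Fin (n + 2)) (Fin (n + 2)) ℝ}
    (hG : G ∈ lorentzGroup n) : G⁻¹ = lorentzMatrix n * (Gᵀ * lorentzMatrix n) := by
  apply Matrix.inv_eq_left_inv
  rw [Matrix.mul_assoc]
  have : Gᵀ * lorentzMatrix n * G = lorentzMatrix n := hG
  rw [this, lorentzMatrix_mul_self]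

theorem MobiusGroup.inv_mulVec (G : MobiusGroup n) (y : Vec n) :
    G.1⁻¹ *ᵥ y = lorentzMatrix n *ᵥ fun k => lorentzProd (G.1.col k) y := by
  rw [inv_eq_of_mem_lorentzGroup G.mem_lorentzGroup, ← Matrix.mulVec_mulVec,
    ← Matrix.mulVec_mulVec]
  congr 1

/-- The columns of a frame as vector functions. -/
abbrev frameCol (e : ℝ → MobiusGroup n) (j : Fin (n + 2)) (x : ℝ) : Vec n := (e x).1.col j

theorem lorentzProd_col (G : MobiusGroup n) (i j : Fin (n + 2)) :
    lorentzProd (G.1.col i) (G.1.col j) = lorentzProd (stdVec i : Vec n) (stdVec j) := by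
  rw [← lorentzProd_mulVec G.mem_lorentzGroup (stdVec i) (stdVec j)]
  simp

/-- The columns form a basis and the product is nondegenerate, so vector identities can be tested
against the columns. -/
theorem MobiusGroup.eq_of_lorentzProd_col (G : MobiusGroup n) {x y : Vec n}
    (h : ∀ k, lorentzProd (G.1.col k) x = lorentzProd (G.1.col k) y) : x = y := by
  have h1 : G.1⁻¹ *ᵥ x = G.1⁻¹ *ᵥ y := by
    rw [G.inv_mulVec, G.inv_mulVec]
    simp only [h]
  have hu : G.1⁻¹ * G.1 = 1 := by
    rw [inv_eq_of_mem_lorentzGroup G.mem_lorentzGroup, Matrix.mul_assoc]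
    have : G.1ᵀ * lorentzMatrix n * G.1 = lorentzMatrix n := G.mem_lorentzGroup
    rw [this, lorentzMatrix_mul_self]
  have hu' : G.1 * G.1⁻¹ = 1 := mul_eq_one_comm.1 hu
  have h2 := congrArg (fun z => G.1 *ᵥ z) h1
  simpa [Matrix.mulVec_mulVec, hu'] using h2

variable {e : ℝ → MobiusGroup n} {x : ℝ}

/-- For `G` in the Lorentz group `G⁻¹ = S Gᵀ S`. Hence `φ` is given, up to the outer factor `S`, by
products of columns with derivatives of columns. -/
theorem mcForm_eq_mulVec (he : ∀ j, DifferentiableAt ℝ (frameCol e j) x) (i j : Fin (n + 2)) :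
    mcForm e x i j =
      (lorentzMatrix n *ᵥ fun k => lorentzProd ((e x).1.col k) (deriv (frameCol e j) x)) i := by
  rw [← MobiusGroup.inv_mulVec, mcForm, Matrix.mul_apply, Matrix.mulVec, dotProduct]
  refine Finset.sum_congr rfl fun k _ => ?_
  congr 1
  rw [Matrix.of_apply, deriv_pi (fun i => differentiableAt_pi.1 (he j) i)]
  rfl

theorem mcForm_zero (he : ∀ j, DifferentiableAt ℝ (frameCol e j) x) (j : Fin (n + 2)) :
    mcForm e x 0 j =
      -lorentzProd ((e x).1.col (Fin.last (n + 1))) (deriv (frameCol e j) x) := by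
  rw [mcForm_eq_mulVec he, lorentzMatrix_mulVec_zero]

theorem mcForm_of_ne (he : ∀ j, DifferentiableAt ℝ (frameCol e j) x) {i : Fin (n + 2)}
    (h0 : i ≠ 0) (hl : i ≠ Fin.last (n + 1)) (j : Fin (n + 2)) :
    mcForm e x i j = lorentzProd ((e x).1.col i) (deriv (frameCol e j) x) := by
  rw [mcForm_eq_mulVec he, lorentzMatrix_mulVec_of_ne h0 hl]

theorem NormalIndex.ne_zero (α : NormalIndex n) : (α : Fin (n + 2)) ≠ 0 := by
  intro h
  have := α.2.1
  rw [h] at this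
  simp at this

theorem NormalIndex.ne_last (α : NormalIndex n) : (α : Fin (n + 2)) ≠ Fin.last (n + 1) := by
  intro h
  have := α.2.2
  rw [h] at this
  simp at this

theorem NormalIndex.ne_one (α : NormalIndex n) : (α : Fin (n + 2)) ≠ 1 := by
  intro h
  have := α.2.1
  rw [h] at this
  simp at this

theorem one_ne_last (hn : 3 ≤ n) : (1 : Fin (n + 2)) ≠ Fin.last (n + 1) := by
  intro h
  have := congrArg Fin.val h
  simp at this
  omega

theorem two_val (hn : 3 ≤ n) : ((2 : Fin (n + 2)) : ℕ) = 2 := by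
  have h : (2 : ℕ) % (n + 2) = 2 := Nat.mod_eq_of_lt (by omega)
  exact h

/-- The index `2` as a normal index. -/
def NormalIndex.two (hn : 3 ≤ n) : NormalIndex n :=
  ⟨2, by rw [two_val hn]; omega⟩

theorem normal_cases (i : Fin (n + 2)) : i = 0 ∨ i = 1 ∨ i = Fin.last (n + 1) ∨
    ∃ α : NormalIndex n, i = α := by
  by_cases h0 : i = 0
  · exact Or.inl h0
  by_cases h1 : i = 1
  · exact Or.inr (Or.inl h1)
  by_cases hl : i = Fin.last (n + 1)
  · exact Or.inr (Or.inr (Or.inl hl))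
  refine Or.inr (Or.inr (Or.inr ⟨⟨i, ?_, ?_⟩, rfl⟩))
  · have a0 : (i : ℕ) ≠ 0 := fun h => h0 (Fin.ext h)
    have a1 : (i : ℕ) ≠ 1 := fun h => h1 (Fin.ext (by simpa using h))
    omega
  · have al : (i : ℕ) ≠ n + 1 := fun h => hl (Fin.ext (by simpa using h))
    have := i.2
    omega

theorem lorentzProd_stdVec_one (hn : 3 ≤ n) (y : Vec n) :
    lorentzProd (stdVec 1) y = y 1 :=
  lorentzProd_stdVec_of_ne (by simp) (one_ne_last hn) y

theorem differentiableAt_frameCol {V : Set ℝ} (hV : IsOpen V)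
    (he : ∀ i j, ContDiffOn ℝ ∞ (fun x => (e x).1 i j) V) (hx : x ∈ V) (j : Fin (n + 2)) :
    DifferentiableAt ℝ (frameCol e j) x :=
  differentiableAt_pi.2 fun i => ContDiffOn.differentiableAt_of_isOpen hV (he i j) hx

end MaurerCartan

/-! ### Frames and the Frenet apparatus of their first column. -/

section Frames

variable {n : ℕ} {f : ℝ → DarbouxQuadric n} {g : ℝ → Vec n} {V : Set ℝ} {x : ℝ}
  {e : ℝ → MobiusGroup n}

theorem lorentzProd_col_zero (G : MobiusGroup n) (j : Fin (n + 2)) :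
    lorentzProd (G.1.col 0) (G.1.col j) = if j = Fin.last (n + 1) then -1 else 0 := by
  rw [lorentzProd_col, lorentzProd_stdVec_zero, stdVec, Pi.single_apply]
  simp [eq_comm, apply_ite]

theorem lorentzProd_col_last (G : MobiusGroup n) (j : Fin (n + 2)) :
    lorentzProd (G.1.col (Fin.last (n + 1))) (G.1.col j) = if j = 0 then -1 else 0 := by
  rw [lorentzProd_col, lorentzProd_stdVec_last, stdVec, Pi.single_apply]
  simp [eq_comm, apply_ite]

theorem lorentzProd_col_of_ne (G : MobiusGroup n) {i : Fin (n + 2)} (h0 : i ≠ 0)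
    (hl : i ≠ Fin.last (n + 1)) (j : Fin (n + 2)) :
    lorentzProd (G.1.col i) (G.1.col j) = if i = j then 1 else 0 := by
  rw [lorentzProd_col, lorentzProd_stdVec_of_ne h0 hl, stdVec, Pi.single_apply]

theorem contDiffOn_frameCol (he : ∀ i j, ContDiffOn ℝ ∞ (fun x => (e x).1 i j) V)
    (j : Fin (n + 2)) : ContDiffOn ℝ ∞ (frameCol e j) V :=
  contDiffOn_pi.2 fun i => he i j

/-- The derivatives of the columns satisfy the Maurer–Cartan symmetries. -/
theorem lorentzProd_col_deriv (hV : IsOpen V)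
    (he : ∀ i j, ContDiffOn ℝ ∞ (fun x => (e x).1 i j) V) (hx : x ∈ V) (i j : Fin (n + 2)) :
    lorentzProd (frameCol e i x) (deriv (frameCol e j) x) =
      -lorentzProd (frameCol e j x) (deriv (frameCol e i) x) := by
  rw [lorentzProd_comm (frameCol e j x)]
  exact lorentzProd_deriv_of_const hV hx (fun y _ => lorentzProd_col (e y) i j)
    (differentiableAt_frameCol hV he hx i) (differentiableAt_frameCol hV he hx j)

/-- A frame with the columns of the normalized Frenet frame is a special third order frame. -/
theorem isSpecialThirdOrderFrame_of_cols (hn : 3 ≤ n) (h : IsRegularLift g V)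
    (hq : ∀ x ∈ V, 0 < dualLength g x)
    (he : ∀ i j, ContDiffOn ℝ ∞ (fun x => (e x).1 i j) V) (hproj : ∀ x ∈ V, (e x).proj = f x)
    (h0 : ∀ x ∈ V, frameCol e 0 x = vecZero g x) (h1 : ∀ x ∈ V, frameCol e 1 x = vecOne g x)
    (h2 : ∀ x ∈ V, frameCol e 2 x = vecTwo g x)
    (hl : ∀ x ∈ V, frameCol e (Fin.last (n + 1)) x = vecLast g x) :
    IsSpecialThirdOrderFrame f V e := by
  have hd : ∀ x ∈ V, ∀ j, DifferentiableAt ℝ (frameCol e j) x := fun x hx j =>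
    differentiableAt_frameCol h.isOpen he hx j
  have hev : ∀ {a b : ℝ → Vec n}, (∀ x ∈ V, a x = b x) → ∀ x ∈ V, deriv a x = deriv b x := by
    intro a b hab x hx
    refine Filter.EventuallyEq.deriv_eq ?_
    filter_upwards [h.isOpen.mem_nhds hx] with y hy using hab y hy
  have d0 : ∀ x ∈ V, deriv (frameCol e 0) x =
      (liftScale g x * speed g x) • frameCol e 1 x := fun x hx => by
    rw [hev h0 x hx, h.deriv_vecZero hq hx, h1 x hx]
  have hone : ∀ x ∈ V, mcForm e x 1 0 = liftScale g x * speed g x := fun x hx => by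
    rw [mcForm_of_ne (hd x hx) (by simp) (one_ne_last hn), d0 x hx, lorentzProd_smul_right,
      lorentzProd_col_of_ne _ (by simp) (one_ne_last hn)]
    simp
  have n0 : ∀ x, ∀ α : NormalIndex n, lorentzProd ((e x).1.col α) (frameCol e 0 x) = 0 :=
    fun x α => by
      rw [lorentzProd_col_of_ne _ α.ne_zero α.ne_last, if_neg α.ne_zero]
  have n1 : ∀ x, ∀ α : NormalIndex n, lorentzProd ((e x).1.col α) (frameCol e 1 x) = 0 :=
    fun x α => by
      rw [lorentzProd_col_of_ne _ α.ne_zero α.ne_last, if_neg α.ne_one]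
  have nl : ∀ x, ∀ α : NormalIndex n,
      lorentzProd ((e x).1.col α) (frameCol e (Fin.last (n + 1)) x) = 0 :=
    fun x α => by
      rw [lorentzProd_col_of_ne _ α.ne_zero α.ne_last, if_neg α.ne_last]
  -- Skew-symmetry replaces the unknown derivative of column `α` by that of the last column, which
  -- is given by the Frenet formulas.
  have hzero : ∀ x ∈ V, ∀ α : NormalIndex n, mcForm e x 0 α =
      liftScale g x * speed g x * lorentzProd ((e x).1.col α) (frameCol e 2 x) := fun x hx α => by
    rw [mcForm_zero (hd x hx), lorentzProd_col_deriv h.isOpen he hx, neg_neg, hev hl x hx, h2 x hx]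
    exact h.prod_deriv_vecLast hq hx (h0 x hx ▸ n0 x α) (h1 x hx ▸ n1 x α) (hl x hx ▸ nl x α)
  refine ⟨⟨⟨⟨⟨he, hproj⟩, fun x hx α => ?_, fun x hx => ?_⟩, fun x hx α => ?_⟩, fun x hx => ?_,
    fun x hx b hb => ?_⟩, fun x hx => ?_⟩
  · rw [mcForm_of_ne (hd x hx) α.ne_zero α.ne_last, d0 x hx, lorentzProd_smul_right, n1, mul_zero]
  · rw [hone x hx]
    exact mul_pos (liftScale_pos (h.speed_pos x hx) (hq x hx)) (h.speed_pos x hx)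
  · rw [mcForm_of_ne (hd x hx) α.ne_zero α.ne_last, hev h1 x hx]
    exact h.prod_deriv_vecOne hq hx (h0 x hx ▸ n0 x α) (h1 x hx ▸ n1 x α) (hl x hx ▸ nl x α)
  · have := hzero x hx (NormalIndex.two hn)
    rw [lorentzProd_col_of_ne _ (NormalIndex.ne_zero _) (NormalIndex.ne_last _),
      show ((NormalIndex.two hn : NormalIndex n) : Fin (n + 2)) = 2 from rfl, if_pos rfl,
      mul_one] at this
    rw [hone x hx]
    exact this
  · rw [hzero x hx b, lorentzProd_col_of_ne _ b.ne_zero b.ne_last, if_neg, mul_zero]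
    intro hb2
    rw [hb2, two_val hn] at hb
    omega
  · rw [mcForm_zero (hd x hx), d0 x hx, lorentzProd_smul_right, lorentzProd_col_last]
    simp

/-- The Frenet apparatus of the first column of a second order frame. -/
theorem IsSecondOrderFrame.frenet (hn : 3 ≤ n) (hV : IsOpen V) (he : IsSecondOrderFrame f V e)
    (hg : ∀ x ∈ V, g x = frameCol e 0 x) :
    IsRegularLift g V ∧ ∀ x ∈ V,
      speed g x = mcForm e x 1 0 ∧
      tangent g x = frameCol e 1 x + (mcForm e x 0 0 / mcForm e x 1 0) • frameCol e 0 x ∧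
      dualLift g x = frameCol e (Fin.last (n + 1)) x +
        (mcForm e x 0 0 / mcForm e x 1 0) • frameCol e 1 x +
        ((mcForm e x 0 0 / mcForm e x 1 0) ^ 2 / 2) • frameCol e 0 x ∧
      ∀ α : NormalIndex n, lorentzProd (frameCol e α x) (dualNormal g x) = mcForm e x 0 α := by
  have hs := he.smooth
  have hd : ∀ x ∈ V, ∀ j, DifferentiableAt ℝ (frameCol e j) x := fun x hx j =>
    differentiableAt_frameCol hV hs hx j
  have hev : ∀ {a b : ℝ → Vec n}, (∀ x ∈ V, a x = b x) → ∀ x ∈ V, deriv a x = deriv b x := by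
    intro a b hab x hx
    refine Filter.EventuallyEq.deriv_eq ?_
    filter_upwards [hV.mem_nhds hx] with y hy using hab y hy
  have hmcone : ∀ x ∈ V, ∀ j, mcForm e x 1 j = lorentzProd (frameCol e 1 x)
      (deriv (frameCol e j) x) := fun x hx j =>
    mcForm_of_ne (hd x hx) (by simp) (one_ne_last hn) j
  have hmcl : ∀ x ∈ V, ∀ j, lorentzProd (frameCol e (Fin.last (n + 1)) x)
      (deriv (frameCol e j) x) = -mcForm e x 0 j := fun x hx j => by
    rw [mcForm_zero (hd x hx), neg_neg]
  have hmca : ∀ x ∈ V, ∀ (α : NormalIndex n) j, lorentzProd (frameCol e α x)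
      (deriv (frameCol e j) x) = mcForm e x α j := fun x hx α j => by
    rw [mcForm_of_ne (hd x hx) α.ne_zero α.ne_last]
  have hself : ∀ x ∈ V, ∀ j, lorentzProd (frameCol e j x) (deriv (frameCol e j) x) = 0 :=
    fun x hx j => by linarith [lorentzProd_col_deriv hV hs hx j j]
  have l0 : (0 : Fin (n + 2)) ≠ Fin.last (n + 1) := last_ne_zero'.symm
  have l1 := one_ne_last hn
  have c00 : ∀ x, lorentzProd (frameCol e 0 x) (frameCol e 0 x) = 0 := fun x => by
    rw [lorentzProd_col_zero, if_neg l0]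
  have c01 : ∀ x, lorentzProd (frameCol e 0 x) (frameCol e 1 x) = 0 := fun x => by
    rw [lorentzProd_col_zero, if_neg l1]
  have c0l : ∀ x, lorentzProd (frameCol e 0 x) (frameCol e (Fin.last (n + 1)) x) = -1 :=
    fun x => by rw [lorentzProd_col_zero, if_pos rfl]
  have c11 : ∀ x, lorentzProd (frameCol e 1 x) (frameCol e 1 x) = 1 := fun x => by
    rw [lorentzProd_col_of_ne _ (by simp) l1, if_pos rfl]
  have c1l : ∀ x, lorentzProd (frameCol e 1 x) (frameCol e (Fin.last (n + 1)) x) = 0 :=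
    fun x => by rw [lorentzProd_col_of_ne _ (by simp) l1, if_neg l1]
  have cll : ∀ x, lorentzProd (frameCol e (Fin.last (n + 1)) x)
      (frameCol e (Fin.last (n + 1)) x) = 0 := fun x => by
    rw [lorentzProd_col_last, if_neg last_ne_zero']
  have ca0 : ∀ x, ∀ α : NormalIndex n, lorentzProd (frameCol e α x) (frameCol e 0 x) = 0 :=
    fun x α => by rw [lorentzProd_col_of_ne _ α.ne_zero α.ne_last, if_neg α.ne_zero]
  have ca1 : ∀ x, ∀ α : NormalIndex n, lorentzProd (frameCol e α x) (frameCol e 1 x) = 0 :=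
    fun x α => by rw [lorentzProd_col_of_ne _ α.ne_zero α.ne_last, if_neg α.ne_one]
  have cal : ∀ x, ∀ α : NormalIndex n,
      lorentzProd (frameCol e α x) (frameCol e (Fin.last (n + 1)) x) = 0 :=
    fun x α => by rw [lorentzProd_col_of_ne _ α.ne_zero α.ne_last, if_neg α.ne_last]
  have c10 : ∀ x, lorentzProd (frameCol e 1 x) (frameCol e 0 x) = 0 := fun x => by
    rw [lorentzProd_comm, c01]
  have cl0 : ∀ x, lorentzProd (frameCol e (Fin.last (n + 1)) x) (frameCol e 0 x) = -1 :=
    fun x => by rw [lorentzProd_comm, c0l]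
  have cl1 : ∀ x, lorentzProd (frameCol e (Fin.last (n + 1)) x) (frameCol e 1 x) = 0 :=
    fun x => by rw [lorentzProd_comm, c1l]
  have spos := he.oriented
  -- The structure equations for the columns 0 and 1: the frame conditions remove all normal
  -- components.
  have d0 : ∀ x ∈ V, deriv (frameCol e 0) x =
      mcForm e x 0 0 • frameCol e 0 x + mcForm e x 1 0 • frameCol e 1 x := fun x hx => by
    refine (e x).eq_of_lorentzProd_col fun k => ?_
    change lorentzProd (frameCol e k x) _ = lorentzProd (frameCol e k x) _
    simp only [lorentzProd_add_right, lorentzProd_smul_right]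
    rcases normal_cases k with rfl | rfl | rfl | ⟨α, rfl⟩
    · rw [hself x hx, c00, c01]
      ring
    · rw [hmcone x hx 0, c10, c11]
      ring
    · rw [hmcl x hx, cl0, cl1]
      ring
    · rw [hmca x hx, he.phi_normal_zero x hx, ca0, ca1]
      ring
  have d1 : ∀ x ∈ V, deriv (frameCol e 1) x = mcForm e x 0 1 • frameCol e 0 x +
      mcForm e x 1 0 • frameCol e (Fin.last (n + 1)) x := fun x hx => by
    refine (e x).eq_of_lorentzProd_col fun k => ?_
    change lorentzProd (frameCol e k x) _ = lorentzProd (frameCol e k x) _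
    simp only [lorentzProd_add_right, lorentzProd_smul_right]
    rcases normal_cases k with rfl | rfl | rfl | ⟨α, rfl⟩
    · rw [lorentzProd_col_deriv hV hs hx, hmcone x hx 0, c00, c0l]
      ring
    · rw [hself x hx, c10, c1l]
      ring
    · rw [hmcl x hx, cl0, cll]
      ring
    · rw [hmca x hx, he.phi_normal_one x hx, ca0, cal]
      ring
  have hspeed : ∀ x ∈ V, speed g x = mcForm e x 1 0 := fun x hx => by
    rw [speed, hev hg x hx, d0 x hx]
    simp only [lorentzProd_add_right, lorentzProd_smul_right, lorentzProd_add_left,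
      lorentzProd_smul_left, c00, c01, c10, c11]
    rw [mul_zero, mul_zero, zero_add, mul_zero, zero_add, zero_add, mul_one,
      Real.sqrt_mul_self (spos x hx).le]
  have hreg : IsRegularLift g V := ⟨hV, (contDiffOn_frameCol hs 0).congr hg,
    fun x hx => by rw [hg x hx, c00], fun x hx => by rw [hspeed x hx]; exact spos x hx⟩
  have htan : ∀ x ∈ V, tangent g x =
      frameCol e 1 x + (mcForm e x 0 0 / mcForm e x 1 0) • frameCol e 0 x := fun x hx => by
    have := (spos x hx).ne'
    rw [tangent, hspeed x hx, hev hg x hx, d0 x hx, smul_add, smul_smul, smul_smul,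
      inv_mul_cancel₀ this, inv_mul_eq_div, one_smul, add_comm]
  have hh : ∀ x ∈ V, DifferentiableAt ℝ (fun x => mcForm e x 0 0 / mcForm e x 1 0) x := by
    intro x hx
    have hdc := (contDiffOn_frameCol hs 0).deriv_of_isOpen hV (m := ∞) (by simp)
    have k0 : ContDiffOn ℝ ∞ (fun x => mcForm e x 0 0) V :=
      (ContDiffOn.lorentzProd (contDiffOn_frameCol hs _) hdc).neg.congr
        fun y hy => mcForm_zero (hd y hy) 0
    have k1 : ContDiffOn ℝ ∞ (fun x => mcForm e x 1 0) V :=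
      (ContDiffOn.lorentzProd (contDiffOn_frameCol hs 1) hdc).congr fun y hy => hmcone y hy 0
    exact ContDiffOn.differentiableAt_of_isOpen hV (k0.div k1 fun y hy => (spos y hy).ne') hx
  have hdual : ∀ x ∈ V, dualLift g x = frameCol e (Fin.last (n + 1)) x +
        (mcForm e x 0 0 / mcForm e x 1 0) • frameCol e 1 x +
        ((mcForm e x 0 0 / mcForm e x 1 0) ^ 2 / 2) • frameCol e 0 x := fun x hx => by
    have hne := (spos x hx).ne'
    have hdt := ((hd x hx 1).hasDerivAt.add
      ((hh x hx).hasDerivAt.smul (hd x hx 0).hasDerivAt)).deriv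
    have hdt' : deriv (tangent g) x = deriv (frameCol e 1) x +
        ((mcForm e x 0 0 / mcForm e x 1 0) • deriv (frameCol e 0) x +
        deriv (fun x => mcForm e x 0 0 / mcForm e x 1 0) x • frameCol e 0 x) := by
      rw [hev htan x hx]
      exact hdt
    -- The derivative of the ratio enters `T'` only along `g`. It is absorbed by `liftCurv` and
    -- cancels in the dual lift, so its value is not needed.
    generalize deriv (fun x => mcForm e x 0 0 / mcForm e x 1 0) x = h' at hdt'
    rw [d0 x hx, d1 x hx] at hdt'
    have hcoef : liftCurv g x = mcForm e x 0 1 + h' +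
        (mcForm e x 0 0 / mcForm e x 1 0) * mcForm e x 0 0 -
        (mcForm e x 0 0 / mcForm e x 1 0) ^ 2 / 2 * mcForm e x 1 0 := by
      rw [liftCurv, hspeed x hx, hdt']
      simp only [lorentzProd_add_right, lorentzProd_smul_right, lorentzProd_add_left,
        lorentzProd_smul_left, c00, c01, c10, c11, c0l, cl0, c1l, cl1, cll]
      field_simp
      ring
    rw [dualLift, hspeed x hx, hcoef, hdt', hg x hx]
    refine (e x).eq_of_lorentzProd_col fun k => ?_
    simp only [lorentzProd_add_right, lorentzProd_smul_right, lorentzProd_sub_right]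
    field_simp
    ring
  refine ⟨hreg, fun x hx => ⟨hspeed x hx, htan x hx, hdual x hx, fun α => ?_⟩⟩
  have hdl := (((hd x hx (Fin.last (n + 1))).hasDerivAt.add
      ((hh x hx).hasDerivAt.smul (hd x hx 1).hasDerivAt)).add
      ((((hh x hx).hasDerivAt.pow 2).div_const 2).smul (hd x hx 0).hasDerivAt)).deriv
  have hdl' := hev hdual x hx
  rw [dualNormal, hdl', htan x hx]
  erw [hdl]
  -- Paired with a normal column, every term vanishes except the derivative of column `n + 1`, whose
  -- pairing is `φ^0_α` by skew-symmetry.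
  simp only [lorentzProd_add_right, lorentzProd_smul_right, lorentzProd_sub_right, ca0, ca1, cal,
    d0 x hx, d1 x hx]
  rw [lorentzProd_col_deriv hV hs hx, hmcl x hx]
  ring

end Frames

/-! ### Special frames are reproduced by the normalized Frenet construction. -/

section Reproduce

variable {n : ℕ} {f : ℝ → DarbouxQuadric n} {g : ℝ → Vec n} {V : Set ℝ} {x : ℝ}
  {e : ℝ → MobiusGroup n}

/-- The normalized Frenet frame of the first column of a special third order frame is the frame
itself. -/
theorem IsSpecialThirdOrderFrame.frenet (hn : 3 ≤ n) (hV : IsOpen V)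
    (he : IsSpecialThirdOrderFrame f V e) (hg : ∀ x ∈ V, g x = frameCol e 0 x) (hx : x ∈ V) :
    0 < speed g x ∧ 0 < dualLength g x ∧ vecZero g x = frameCol e 0 x ∧
      vecOne g x = frameCol e 1 x ∧ vecTwo g x = frameCol e 2 x ∧
      vecLast g x = frameCol e (Fin.last (n + 1)) x := by
  obtain ⟨hreg, hfr⟩ := he.toIsSecondOrderFrame.frenet hn hV hg
  have hnormal : ∀ x ∈ V, dualNormal g x = mcForm e x 1 0 • frameCol e 2 x := fun x hx => by
    obtain ⟨h1, h2, h3, h4⟩ := hfr x hx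
    rw [he.phi_zero_zero x hx, zero_div, zero_smul, add_zero] at h2
    rw [he.phi_zero_zero x hx] at h3
    simp only [zero_div, zero_smul, add_zero, ne_eq, OfNat.ofNat_ne_zero, not_false_eq_true,
      zero_pow] at h3
    have two : ((NormalIndex.two hn : NormalIndex n) : Fin (n + 2)) = 2 := rfl
    refine (e x).eq_of_lorentzProd_col fun k => ?_
    change lorentzProd (frameCol e k x) _ = lorentzProd (frameCol e k x) _
    rw [lorentzProd_smul_right, lorentzProd_comm _ (frameCol e 2 x), ← two,
      lorentzProd_col_of_ne _ (NormalIndex.ne_zero _) (NormalIndex.ne_last _)]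
    rcases normal_cases k with rfl | rfl | rfl | ⟨α, rfl⟩
    · rw [← hg x hx, hreg.prod_lift_dualNormal hx, if_neg (NormalIndex.ne_zero _), mul_zero]
    · rw [← h2, hreg.prod_tangent_dualNormal hx, if_neg (NormalIndex.ne_one _), mul_zero]
    · rw [← h3, hreg.prod_dualLift_dualNormal hx, if_neg (NormalIndex.ne_last _), mul_zero]
    · rw [h4 α]
      by_cases hα : ((NormalIndex.two hn : NormalIndex n) : Fin (n + 2)) = α
      · rw [if_pos hα, ← hα, mul_one, two, he.phi_zero_two x hx]
      · rw [if_neg hα, mul_zero]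
        refine he.phi_zero_b x hx α ?_
        have h5 := α.2.1
        have h6 : (α.1 : ℕ) ≠ 2 := fun h6 => hα (Fin.ext (by rw [h6, two, two_val hn]))
        omega
  have hlen : ∀ x ∈ V, dualLength g x = mcForm e x 1 0 := fun x hx => by
    rw [dualLength, hnormal x hx, lorentzProd_smul_left, lorentzProd_smul_right]
    have two : ((NormalIndex.two hn : NormalIndex n) : Fin (n + 2)) = 2 := rfl
    rw [← two, lorentzProd_col_of_ne _ (NormalIndex.ne_zero _) (NormalIndex.ne_last _),
      if_pos rfl, mul_one, Real.sqrt_mul_self (he.oriented x hx).le]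
  -- Speed and dual length are both `φ^1_0`, so the scale is constantly 1 and the shift vanishes.
  have hscale : ∀ x ∈ V, liftScale g x = 1 := fun x hx => by
    rw [liftScale, hlen x hx, (hfr x hx).1, div_self (he.oriented x hx).ne', Real.sqrt_one]
  have hshift : liftShift g x = 0 := by
    have : deriv (liftScale g) x = 0 := by
      have h1 : liftScale g =ᶠ[nhds x] fun _ => (1 : ℝ) := by
        filter_upwards [hV.mem_nhds hx] with y hy using hscale y hy
      rw [h1.deriv_eq, deriv_const]
    rw [liftShift, this, zero_div]
  obtain ⟨h1, h2, h3, h4⟩ := hfr x hx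
  rw [he.phi_zero_zero x hx, zero_div, zero_smul, add_zero] at h2
  rw [he.phi_zero_zero x hx] at h3
  simp only [zero_div, zero_smul, add_zero, ne_eq, OfNat.ofNat_ne_zero, not_false_eq_true,
      zero_pow] at h3
  refine ⟨hreg.speed_pos x hx, ?_, ?_, ?_, ?_, ?_⟩
  · rw [hlen x hx]
    exact he.oriented x hx
  · rw [vecZero, hscale x hx, one_smul, hg x hx]
  · rw [vecOne, hshift, zero_smul, add_zero, h2]
  · rw [vecTwo, hlen x hx, hnormal x hx, smul_smul, inv_mul_cancel₀ (he.oriented x hx).ne',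
      one_smul]
  · rw [vecLast, hshift, hscale x hx, h3]
    simp

end Reproduce

/-! ### Changes of frame that fix the point of the quadric, inside the identity component. -/

section Isotropy

variable {n : ℕ}

/-- Left multiplication of a Möbius transformation by a plane move. -/
def MobiusGroup.move (A : MobiusGroup n) (a b : Vec n) (h : moveMatrix a b ∈ mobiusSet n) :
    MobiusGroup n :=
  ⟨moveMatrix a b * A.1, mul_mem_mobiusSet h A.2⟩

theorem MobiusGroup.move_col (A : MobiusGroup n) (a b : Vec n)
    (h : moveMatrix a b ∈ mobiusSet n) (j : Fin (n + 2)) :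
    (A.move a b h).1.col j = moveMatrix a b *ᵥ A.1.col j := by
  rw [← Matrix.mulVec_single_one, ← Matrix.mulVec_single_one, Matrix.mulVec_mulVec]
  rfl

/-- Obtained as the move of `e_1` to `e_1 + Y e_0`, two unit vectors of product 1. Everything
orthogonal to both is fixed, and column `n + 1` is computed directly. -/
theorem exists_translate (hn : 3 ≤ n) (A : MobiusGroup n) (Y : ℝ) : ∃ M : MobiusGroup n,
    M.1.col 0 = A.1.col 0 ∧ M.1.col 1 = A.1.col 1 + Y • A.1.col 0 ∧
    M.1.col (Fin.last (n + 1)) =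
      A.1.col (Fin.last (n + 1)) + Y • A.1.col 1 + (Y ^ 2 / 2) • A.1.col 0 ∧
    ∀ α : NormalIndex n, M.1.col α = A.1.col α := by
  have l0 : (0 : Fin (n + 2)) ≠ Fin.last (n + 1) := last_ne_zero'.symm
  have l1 := one_ne_last hn
  have c00 : lorentzProd (A.1.col 0) (A.1.col 0) = 0 := by rw [lorentzProd_col_zero, if_neg l0]
  have c01 : lorentzProd (A.1.col 0) (A.1.col 1) = 0 := by rw [lorentzProd_col_zero, if_neg l1]
  have c10 : lorentzProd (A.1.col 1) (A.1.col 0) = 0 := by rw [lorentzProd_comm, c01]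
  have c11 : lorentzProd (A.1.col 1) (A.1.col 1) = 1 := by
    rw [lorentzProd_col_of_ne _ (by simp) l1, if_pos rfl]
  have c1l : lorentzProd (A.1.col 1) (A.1.col (Fin.last (n + 1))) = 0 := by
    rw [lorentzProd_col_of_ne _ (by simp) l1, if_neg l1]
  have c0l : lorentzProd (A.1.col 0) (A.1.col (Fin.last (n + 1))) = -1 := by
    rw [lorentzProd_col_zero, if_pos rfl]
  have hbb : lorentzProd (A.1.col 1 + Y • A.1.col 0) (A.1.col 1 + Y • A.1.col 0) =
      lorentzProd (A.1.col 1) (A.1.col 1) := by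
    simp [c00, c01, c10]
  have hab : lorentzProd (A.1.col 1) (A.1.col 1 + Y • A.1.col 0) = 1 := by
    simp [c10, c11]
  refine ⟨A.move (A.1.col 1) (A.1.col 1 + Y • A.1.col 0)
    (moveMatrix_mem hbb (by rw [c11]; norm_num) (by rw [hab, c11]; norm_num)), ?_, ?_, ?_, ?_⟩
  · rw [MobiusGroup.move_col]
    exact moveMatrix_apply_of_orthogonal c10 (by simp [c00, c10])
  · rw [MobiusGroup.move_col]
    exact moveMatrix_apply_left hbb (by rw [c11]; norm_num) (by rw [hab, c11]; norm_num)
  · rw [MobiusGroup.move_col, moveMatrix_mulVec, reflMatrix_mulVec (A.1.col 1), c1l,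
      reflMatrix_mulVec]
    have e1 : lorentzProd (A.1.col 1 + (A.1.col 1 + Y • A.1.col 0))
        (A.1.col 1 + (A.1.col 1 + Y • A.1.col 0)) = 4 := by
      simp [c00, c01, c10, c11]
      norm_num
    have e2 : lorentzProd (A.1.col 1 + (A.1.col 1 + Y • A.1.col 0))
        (A.1.col (Fin.last (n + 1)) - (2 * 0 / lorentzProd (A.1.col 1) (A.1.col 1)) • A.1.col 1)
          = -Y := by
      simp [c1l, c0l]
    rw [e1, e2]
    module
  · intro α
    rw [MobiusGroup.move_col]
    have ca0 : lorentzProd (A.1.col α) (A.1.col 0) = 0 := by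
      rw [lorentzProd_col_of_ne _ α.ne_zero α.ne_last, if_neg α.ne_zero]
    have ca1 : lorentzProd (A.1.col α) (A.1.col 1) = 0 := by
      rw [lorentzProd_col_of_ne _ α.ne_zero α.ne_last, if_neg α.ne_one]
    rw [lorentzProd_comm] at ca0 ca1
    exact moveMatrix_apply_of_orthogonal ca1 (by simp [ca0, ca1])

/-- Obtained as the move of the timelike vector `e_0 + e_{n+1}` to `r e_0 + r⁻¹ e_{n+1}`. The image
of `e_0` is computed, and that of `e_{n+1}` follows by subtraction. -/
theorem exists_boost (hn : 3 ≤ n) (A : MobiusGroup n) {r : ℝ} (hr : 0 < r) :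
    ∃ M : MobiusGroup n, M.1.col 0 = r • A.1.col 0 ∧ M.1.col 1 = A.1.col 1 ∧
    M.1.col (Fin.last (n + 1)) = r⁻¹ • A.1.col (Fin.last (n + 1)) ∧
    ∀ α : NormalIndex n, M.1.col α = A.1.col α := by
  have l0 : (0 : Fin (n + 2)) ≠ Fin.last (n + 1) := last_ne_zero'.symm
  have l1 := one_ne_last hn
  have c00 : lorentzProd (A.1.col 0) (A.1.col 0) = 0 := by rw [lorentzProd_col_zero, if_neg l0]
  have c0l : lorentzProd (A.1.col 0) (A.1.col (Fin.last (n + 1))) = -1 := by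
    rw [lorentzProd_col_zero, if_pos rfl]
  have cl0 : lorentzProd (A.1.col (Fin.last (n + 1))) (A.1.col 0) = -1 := by
    rw [lorentzProd_comm, c0l]
  have cll : lorentzProd (A.1.col (Fin.last (n + 1))) (A.1.col (Fin.last (n + 1))) = 0 := by
    rw [lorentzProd_col_last, if_neg last_ne_zero']
  have c01 : lorentzProd (A.1.col 0) (A.1.col 1) = 0 := by rw [lorentzProd_col_zero, if_neg l1]
  have cl1 : lorentzProd (A.1.col (Fin.last (n + 1))) (A.1.col 1) = 0 := by
    rw [lorentzProd_col_last, if_neg (by simp)]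
  set a := A.1.col 0 + A.1.col (Fin.last (n + 1)) with ha
  set b := r • A.1.col 0 + r⁻¹ • A.1.col (Fin.last (n + 1)) with hb
  have haa : lorentzProd a a = -2 := by
    simp [ha, c00, c0l, cl0, cll]
    norm_num
  have hbb : lorentzProd b b = lorentzProd a a := by
    rw [haa]
    simp [hb, c00, c0l, cl0, cll]
    field_simp
    norm_num
  have hab : lorentzProd a b = -(r + r⁻¹) := by
    simp [ha, hb, c00, c0l, cl0, cll]
    ring
  have hri : 0 < r⁻¹ := inv_pos.2 hr
  have hne : lorentzProd a a ≠ 0 := by rw [haa]; norm_num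
  have hne2 : lorentzProd a b + lorentzProd a a ≠ 0 := by rw [hab, haa]; linarith
  have key : moveMatrix a b *ᵥ A.1.col 0 = r • A.1.col 0 := by
    rw [moveMatrix_mulVec, reflMatrix_mulVec a, haa]
    have e0 : lorentzProd a (A.1.col 0) = -1 := by simp [ha, c00, cl0]
    have e1 : A.1.col 0 - (2 * lorentzProd a (A.1.col 0) / -2) • a =
        -A.1.col (Fin.last (n + 1)) := by
      rw [e0, ha]
      module
    rw [e1, reflMatrix_mulVec]
    have e2 : lorentzProd (a + b) (a + b) = -2 * (1 + r) ^ 2 / r := by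
      rw [lorentzProd_add_self, hbb, haa, hab]
      field_simp
      ring
    have e3 : lorentzProd (a + b) (-A.1.col (Fin.last (n + 1))) = 1 + r := by
      simp [ha, hb, c0l, cll]
      ring
    have e4 : 2 * (1 + r) / (-2 * (1 + r) ^ 2 / r) = -(r / (1 + r)) := by
      field_simp
    have e5 : a + b = (1 + r) • A.1.col 0 + ((1 + r) / r) • A.1.col (Fin.last (n + 1)) := by
      have : (1 + r) / r = 1 + r⁻¹ := by
        field_simp
        ring
      rw [ha, hb, this]
      module
    rw [e2, e3, e4, e5, smul_add, smul_smul, smul_smul]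
    have e6 : -(r / (1 + r)) * (1 + r) = -r := by field_simp
    have e7 : -(r / (1 + r)) * ((1 + r) / r) = -1 := by field_simp
    rw [e6, e7]
    module
  refine ⟨A.move a b (moveMatrix_mem hbb hne (by rw [hab, haa]; linarith)), ?_, ?_, ?_, ?_⟩
  · rw [MobiusGroup.move_col, key]
  · rw [MobiusGroup.move_col]
    exact moveMatrix_apply_of_orthogonal (by simp [ha, c01, cl1]) (by simp [hb, c01, cl1])
  · rw [MobiusGroup.move_col]
    have h1 := moveMatrix_apply_left hbb hne hne2
    nth_rewrite 2 [ha] at h1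
    rw [Matrix.mulVec_add, key, hb] at h1
    exact add_left_cancel h1
  · intro α
    rw [MobiusGroup.move_col]
    have ca0 : lorentzProd (A.1.col 0) (A.1.col α) = 0 := by
      rw [lorentzProd_col_zero, if_neg α.ne_last]
    have cal : lorentzProd (A.1.col (Fin.last (n + 1))) (A.1.col α) = 0 := by
      rw [lorentzProd_col_last, if_neg α.ne_zero]
    exact moveMatrix_apply_of_orthogonal (by simp [ha, ca0, cal]) (by simp [hb, ca0, cal])

/-- The move straight from `e_2` to `a` breaks down at `a = -e_2`, so the rotation passes through
`±e_3`. -/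
theorem exists_rotate (hn : 3 ≤ n) (A : MobiusGroup n) {a : Vec n} (haa : lorentzProd a a = 1)
    (h0 : lorentzProd a (A.1.col 0) = 0) (h1 : lorentzProd a (A.1.col 1) = 0)
    (hl : lorentzProd a (A.1.col (Fin.last (n + 1))) = 0) :
    ∃ M : MobiusGroup n, M.1.col 0 = A.1.col 0 ∧ M.1.col 1 = A.1.col 1 ∧
    M.1.col (Fin.last (n + 1)) = A.1.col (Fin.last (n + 1)) ∧ M.1.col 2 = a := by
  let two := NormalIndex.two hn
  -- This second normal direction exists because `n ≥ 3`.
  let three : NormalIndex n := ⟨⟨3, by omega⟩, by simp; omega⟩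
  have h23 : (two : Fin (n + 2)) ≠ three := by
    intro h
    have := congrArg Fin.val h
    change ((2 : Fin (n + 2)) : ℕ) = 3 at this
    rw [two_val hn] at this
    omega
  have orth : ∀ α : NormalIndex n, lorentzProd (A.1.col α) (A.1.col 0) = 0 ∧
      lorentzProd (A.1.col α) (A.1.col 1) = 0 ∧
      lorentzProd (A.1.col α) (A.1.col (Fin.last (n + 1))) = 0 := fun α => by
    refine ⟨?_, ?_, ?_⟩
    · rw [lorentzProd_col_of_ne _ α.ne_zero α.ne_last, if_neg α.ne_zero]
    · rw [lorentzProd_col_of_ne _ α.ne_zero α.ne_last, if_neg α.ne_one]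
    · rw [lorentzProd_col_of_ne _ α.ne_zero α.ne_last, if_neg α.ne_last]
  -- The sign makes `⟨c, a⟩ ≥ 0`. Both moves, `e_2` to `c` and `c` to `a`, then satisfy the
  -- positivity condition.
  obtain ⟨c, hc, hcc, hca⟩ : ∃ c : Vec n, (c = A.1.col three ∨ c = -A.1.col three) ∧
      lorentzProd c c = 1 ∧ 0 ≤ lorentzProd c a := by
    have h33 : lorentzProd (A.1.col three) (A.1.col three) = 1 := by
      rw [lorentzProd_col_of_ne _ three.ne_zero three.ne_last, if_pos rfl]
    rcases le_total 0 (lorentzProd (A.1.col three) a) with h | h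
    · exact ⟨_, Or.inl rfl, h33, h⟩
    · exact ⟨_, Or.inr rfl, by simp [h33], by simpa using h⟩
  have corth : ∀ v, lorentzProd (A.1.col three) v = 0 → lorentzProd c v = 0 := by
    intro v hv
    rcases hc with rfl | rfl
    · exact hv
    · simp [hv]
  have h22 : lorentzProd (A.1.col two) (A.1.col two) = 1 := by
    rw [lorentzProd_col_of_ne _ two.ne_zero two.ne_last, if_pos rfl]
  have h2c : lorentzProd (A.1.col two) c = 0 := by
    rw [lorentzProd_comm]
    refine corth _ ?_
    rw [lorentzProd_comm, lorentzProd_col_of_ne _ two.ne_zero two.ne_last, if_neg h23]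
  have m1 : moveMatrix (A.1.col two) c ∈ mobiusSet n :=
    moveMatrix_mem (by rw [hcc, h22]) (by rw [h22]; norm_num) (by rw [h22, h2c]; norm_num)
  have m2 : moveMatrix c a ∈ mobiusSet n :=
    moveMatrix_mem (by rw [haa, hcc]) (by rw [hcc]; norm_num) (by rw [hcc]; linarith)
  have fix : ∀ j, lorentzProd (A.1.col two) (A.1.col j) = 0 →
      lorentzProd (A.1.col three) (A.1.col j) = 0 → lorentzProd a (A.1.col j) = 0 →
      ((A.move _ _ m1).move _ _ m2).1.col j = A.1.col j := by
    intro j h2 h3 ha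
    rw [MobiusGroup.move_col, MobiusGroup.move_col,
      moveMatrix_apply_of_orthogonal h2 (corth _ h3),
      moveMatrix_apply_of_orthogonal (corth _ h3) ha]
  refine ⟨(A.move _ _ m1).move _ _ m2, fix 0 (orth two).1 (orth three).1 h0,
    fix 1 (orth two).2.1 (orth three).2.1 h1, fix _ (orth two).2.2 (orth three).2.2 hl, ?_⟩
  rw [MobiusGroup.move_col, MobiusGroup.move_col]
  change moveMatrix c a *ᵥ (moveMatrix (A.1.col two) c *ᵥ A.1.col two) = a
  rw [moveMatrix_apply_left (by rw [hcc, h22]) (by rw [h22]; norm_num)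
      (by rw [h22, h2c]; norm_num),
    moveMatrix_apply_left (by rw [haa, hcc]) (by rw [hcc]; norm_num) (by rw [hcc]; linarith)]

end Isotropy

/-! ### A normalized transformation at a single 1-generic point. -/

section Initial

variable {n : ℕ} {f : ℝ → DarbouxQuadric n} {g : ℝ → Vec n} {V : Set ℝ} {x : ℝ}
  {e : ℝ → MobiusGroup n}

/-- A vector orthogonal to the columns `0` and `n + 1` of a Möbius transformation has positive
square, unless it vanishes. -/
theorem lorentzProd_self_pos (A : MobiusGroup n) {a : Vec n} (ha : a ≠ 0)
    (h0 : lorentzProd (A.1.col 0) a = 0) (hl : lorentzProd (A.1.col (Fin.last (n + 1))) a = 0) :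
    0 < lorentzProd a a := by
  have hu : A.1⁻¹ * A.1 = 1 := by
    rw [inv_eq_of_mem_lorentzGroup A.mem_lorentzGroup, Matrix.mul_assoc]
    have : A.1ᵀ * lorentzMatrix n * A.1 = lorentzMatrix n := A.mem_lorentzGroup
    rw [this, lorentzMatrix_mul_self]
  have hu' : A.1 * A.1⁻¹ = 1 := mul_eq_one_comm.1 hu
  set b := A.1⁻¹ *ᵥ a with hb
  have hab : A.1 *ᵥ b = a := by rw [hb, Matrix.mulVec_mulVec, hu', Matrix.one_mulVec]
  -- In the coordinates given by the columns of `A`, the vanishing of coordinate 0 reduces the form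
  -- to a sum of squares.
  have hb0 : b 0 = 0 := by
    rw [hb, A.inv_mulVec, lorentzMatrix_mulVec_zero, hl, neg_zero]
  have hform : lorentzProd a a = ∑ i : Fin n, b i.succ.castSucc ^ 2 := by
    rw [← hab, lorentzProd_mulVec A.mem_lorentzGroup, lorentzProd_self, lorentzForm_eq, hb0]
    ring
  have hbl : b (Fin.last (n + 1)) = 0 := by
    rw [hb, A.inv_mulVec, lorentzMatrix_mulVec_last, h0, neg_zero]
  rw [hform]
  refine lt_of_le_of_ne (Finset.sum_nonneg fun i _ => sq_nonneg _) fun hz => ?_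
  have hz' := (Finset.sum_eq_zero_iff_of_nonneg fun i _ => sq_nonneg _).1 hz.symm
  apply ha
  rw [← hab]
  have : b = 0 := by
    funext i
    refine Fin.lastCases ?_ (fun j => ?_) i
    · exact hbl
    · refine Fin.cases ?_ (fun A => ?_) j
      · exact hb0
      · simpa using hz' A (Finset.mem_univ A)
  rw [this, Matrix.mulVec_zero]

/-- At a `1`-generic point, a second order frame can be changed into one whose columns are the
normalized Frenet frame. -/
theorem IsSecondOrderFrame.exists_normalized (hn : 3 ≤ n) (hV : IsOpen V)
    (he : IsSecondOrderFrame f V e) (hx : x ∈ V)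
    (hp : ∑ α : NormalIndex n, pCoeff e x α ^ 2 ≠ 0) :
    0 < dualLength (frameCol e 0) x ∧ ∃ M : MobiusGroup n,
      M.1.col 0 = vecZero (frameCol e 0) x ∧ M.1.col 1 = vecOne (frameCol e 0) x ∧
      M.1.col 2 = vecTwo (frameCol e 0) x ∧
      M.1.col (Fin.last (n + 1)) = vecLast (frameCol e 0) x := by
  obtain ⟨hreg, hfr⟩ := he.frenet (g := frameCol e 0) hn hV fun _ _ => rfl
  obtain ⟨h1, h2, h3, h4⟩ := hfr x hx
  set h := mcForm e x 0 0 / mcForm e x 1 0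
  set g := frameCol e 0 with hg
  have q0 : lorentzProd (g x) (dualNormal g x) = 0 := hreg.prod_lift_dualNormal hx
  have q1 : lorentzProd (frameCol e 1 x) (dualNormal g x) = 0 := by
    have := hreg.prod_tangent_dualNormal hx
    rw [h2, lorentzProd_add_left, lorentzProd_smul_left] at this
    change _ + _ * lorentzProd (g x) _ = 0 at this
    linarith [congrArg (fun z => h * z) q0]
  have ql : lorentzProd (frameCol e (Fin.last (n + 1)) x) (dualNormal g x) = 0 := by
    have := hreg.prod_dualLift_dualNormal hx
    rw [h3, lorentzProd_add_left, lorentzProd_add_left, lorentzProd_smul_left,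
      lorentzProd_smul_left, q1] at this
    change _ + _ + _ * lorentzProd (g x) _ = 0 at this
    rw [q0] at this
    linarith
  change lorentzProd ((e x).1.col 0) _ = 0 at q0
  change lorentzProd ((e x).1.col 1) _ = 0 at q1
  change lorentzProd ((e x).1.col (Fin.last (n + 1))) _ = 0 at ql
  -- The components of this vector along the normal columns are the `φ^0_α`, so 1-genericity
  -- excludes zero.
  have hne : dualNormal g x ≠ 0 := by
    intro hz
    apply hp
    refine Finset.sum_eq_zero fun α _ => ?_
    have := h4 α
    rw [hz, lorentzProd_zero_right] at this
    rw [pCoeff, ← this]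
    simp
  have hlen : 0 < dualLength g x := Real.sqrt_pos.2 (lorentzProd_self_pos (e x) hne q0 ql)
  refine ⟨hlen, ?_⟩
  have hr := liftScale_pos (hreg.speed_pos x hx) hlen
  -- The tangent vector is `e_1 + h e_0`, and `vecOne` adds another `liftShift` multiple of `e_0`;
  -- the two translations add up.
  obtain ⟨A, a0, a1, al, -⟩ := exists_translate hn (e x) (h + liftShift g x)
  obtain ⟨B, b0, b1, bl, -⟩ := exists_boost hn A hr
  have horth : ∀ v, lorentzProd v (dualNormal g x) = 0 → lorentzProd (vecTwo g x) v = 0 := by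
    intro v hv
    rw [vecTwo, lorentzProd_smul_left, lorentzProd_comm, hv, mul_zero]
  obtain ⟨M, m0, m1, ml, m2⟩ := exists_rotate hn B (a := vecTwo g x) (by
      rw [vecTwo, lorentzProd_smul_left, lorentzProd_smul_right, dualLength_sq hlen]
      field_simp)
    (horth _ (by rw [b0, a0]; simp [q0])) (horth _ (by rw [b1, a1]; simp [q0, q1]))
    (horth _ (by rw [bl, al]; simp [q0, q1, ql]))
  refine ⟨M, ?_, ?_, m2, ?_⟩
  · rw [m0, b0, a0, vecZero]
  · rw [m1, b1, a1, vecOne, h2]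
    change _ + _ • g x = _ + _ • g x + _ • g x
    module
  · rw [ml, bl, al, vecLast, h3, h2]
    change _ • (_ + _ • frameCol e 1 x + _ • g x) = _ • (_ + _ • _ + _ • g x + _ • (_ + _ • g x) + _)
    module

end Initial

/-! ### Smooth completion of four prescribed columns to a Möbius frame. -/

section Completion

variable {n : ℕ} {W : Set (ℝ × ℝ)} {A : ℝ × ℝ → MobiusGroup n}

theorem contDiffOn_reflMatrix_mulVec {v y : ℝ × ℝ → Vec n} (hv : ContDiffOn ℝ ∞ v W)
    (hy : ContDiffOn ℝ ∞ y W) (hne : ∀ z ∈ W, lorentzProd (v z) (v z) ≠ 0) :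
    ContDiffOn ℝ ∞ (fun z => reflMatrix (v z) *ᵥ y z) W := by
  simp only [reflMatrix_mulVec]
  exact hy.sub (((contDiffOn_const.mul (ContDiffOn.lorentzProd hv hy)).div
    (ContDiffOn.lorentzProd hv hv) hne).smul hv)

theorem contDiffOn_mulVec (hA : ∀ i j, ContDiffOn ℝ ∞ (fun z => (A z).1 i j) W) (c : Vec n) :
    ContDiffOn ℝ ∞ (fun z => (A z).1 *ᵥ c) W := by
  refine contDiffOn_pi.2 fun i => ?_
  simp only [Matrix.mulVec, dotProduct]
  exact ContDiffOn.sum fun j _ => (hA i j).mul contDiffOn_const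

/-- A smooth family of Möbius transformations can be corrected, near the points where it already
does so, to send the vector `c` to prescribed vectors `u`. -/
theorem exists_steer (hW : IsOpen W) (hA : ∀ i j, ContDiffOn ℝ ∞ (fun z => (A z).1 i j) W)
    {c : Vec n} (hc : lorentzProd c c ≠ 0) {u : ℝ × ℝ → Vec n} (hu : ContDiffOn ℝ ∞ u W)
    (huc : ∀ z ∈ W, lorentzProd (u z) (u z) = lorentzProd c c) :
    ∃ (W' : Set (ℝ × ℝ)) (A' : ℝ × ℝ → MobiusGroup n), IsOpen W' ∧ W' ⊆ W ∧
      (∀ i j, ContDiffOn ℝ ∞ (fun z => (A' z).1 i j) W') ∧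
      (∀ z ∈ W', (A' z).1 *ᵥ c = u z) ∧
      (∀ z ∈ W', ∀ d, lorentzProd c d = 0 → lorentzProd (u z) ((A z).1 *ᵥ d) = 0 →
        (A' z).1 *ᵥ d = (A z).1 *ᵥ d) ∧
      ∀ z ∈ W, (A z).1 *ᵥ c = u z → z ∈ W' ∧ A' z = A z := by
  classical
  set a : ℝ × ℝ → Vec n := fun z => (A z).1 *ᵥ c with ha
  have hac : ∀ z, lorentzProd (a z) (a z) = lorentzProd c c := fun z =>
    lorentzProd_mulVec (A z).mem_lorentzGroup c c
  have hasm : ContDiffOn ℝ ∞ a W := contDiffOn_mulVec hA c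
  set φ : ℝ × ℝ → ℝ := fun z => lorentzProd c c * (lorentzProd (a z) (u z) + lorentzProd c c)
  have hφ : ContDiffOn ℝ ∞ φ W :=
    contDiffOn_const.mul ((ContDiffOn.lorentzProd hasm hu).add contDiffOn_const)
  -- The open set where the move from `A c` to `u` is defined and lies in the identity component. It
  -- contains every point with `A c = u`, since there the function equals `2 ⟨c, c⟩^2`.
  set W' : Set (ℝ × ℝ) := W ∩ φ ⁻¹' Set.Ioi 0 with hW'
  have hsub : W' ⊆ W := Set.inter_subset_left
  have hmem : ∀ z ∈ W', moveMatrix (a z) (u z) ∈ mobiusSet n := fun z hz =>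
    moveMatrix_mem (by rw [huc z hz.1, hac]) (by rwa [hac]) (by rw [hac]; exact hz.2)
  have hne : ∀ z ∈ W', lorentzProd (a z) (u z) + lorentzProd c c ≠ 0 := fun z hz h0 => by
    have : 0 < φ z := hz.2
    simp [φ, h0] at this
  -- Off `W'` the move may leave the group, so a default value is used there; it plays no role.
  set A' : ℝ × ℝ → MobiusGroup n := fun z =>
    if h : moveMatrix (a z) (u z) ∈ mobiusSet n then (A z).move (a z) (u z) h else A z with hA'
  have hval : ∀ z ∈ W', ∀ d, (A' z).1 *ᵥ d = moveMatrix (a z) (u z) *ᵥ ((A z).1 *ᵥ d) := by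
    intro z hz d
    rw [hA']
    simp only [dif_pos (hmem z hz)]
    rw [Matrix.mulVec_mulVec]
    rfl
  refine ⟨W', A', hφ.continuousOn.isOpen_inter_preimage hW isOpen_Ioi, hsub, ?_, ?_, ?_, ?_⟩
  · intro i j
    have h1 : ContDiffOn ℝ ∞ (fun z => reflMatrix (a z + u z) *ᵥ
        (reflMatrix (a z) *ᵥ ((A z).1 *ᵥ stdVec j))) W' := by
      refine contDiffOn_reflMatrix_mulVec ((hasm.add hu).mono hsub)
        (contDiffOn_reflMatrix_mulVec (hasm.mono hsub) ((contDiffOn_mulVec hA _).mono hsub)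
          fun z _ => by rwa [hac]) fun z hz => ?_
      rw [lorentzProd_add_self, hac, huc z hz.1]
      intro h0
      exact hne z hz (by linarith)
    refine (contDiffOn_pi.1 h1 i).congr fun z hz => ?_
    have h2 := hval z hz (stdVec j)
    rw [moveMatrix_mulVec] at h2
    rw [← h2, Matrix.mulVec_single_one]
    rfl
  · intro z hz
    rw [hval z hz]
    exact moveMatrix_apply_left (by rw [huc z hz.1, hac]) (by rwa [hac])
      (by rw [hac]; exact hne z hz)
  · intro z hz d hd hud
    rw [hval z hz]
    refine moveMatrix_apply_of_orthogonal ?_ hud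
    rw [ha, lorentzProd_mulVec (A z).mem_lorentzGroup, hd]
  · intro z hz h
    change a z = u z at h
    have hz' : z ∈ W' := by
      refine ⟨hz, ?_⟩
      change 0 < lorentzProd c c * (lorentzProd (a z) (u z) + lorentzProd c c)
      rw [← h, hac]
      have := mul_self_pos.2 hc
      linarith
    refine ⟨hz', ?_⟩
    apply Subtype.ext
    apply Matrix.mulVec_injective
    funext d
    rw [hval z hz', ← h, moveMatrix_self (by rwa [hac]), Matrix.one_mulVec]

/-- Completion of smooth families of vectors to a smooth family of Möbius transformations, near the
points where a given family has these vectors as columns. -/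
theorem exists_completion (hn : 3 ≤ n) (hW : IsOpen W)
    (hA : ∀ i j, ContDiffOn ℝ ∞ (fun z => (A z).1 i j) W) {u0 u1 u2 ul : ℝ × ℝ → Vec n}
    (s0 : ContDiffOn ℝ ∞ u0 W) (s1 : ContDiffOn ℝ ∞ u1 W) (s2 : ContDiffOn ℝ ∞ u2 W)
    (sl : ContDiffOn ℝ ∞ ul W)
    (gram : ∀ z ∈ W, lorentzProd (u0 z) (u0 z) = 0 ∧ lorentzProd (u0 z) (u1 z) = 0 ∧
      lorentzProd (u0 z) (u2 z) = 0 ∧ lorentzProd (u0 z) (ul z) = -1 ∧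
      lorentzProd (u1 z) (u1 z) = 1 ∧ lorentzProd (u1 z) (u2 z) = 0 ∧
      lorentzProd (u1 z) (ul z) = 0 ∧ lorentzProd (u2 z) (u2 z) = 1 ∧
      lorentzProd (u2 z) (ul z) = 0 ∧ lorentzProd (ul z) (ul z) = 0) :
    ∃ (Ω : Set (ℝ × ℝ)) (F : ℝ × ℝ → MobiusGroup n), IsOpen Ω ∧ Ω ⊆ W ∧
      (∀ i j, ContDiffOn ℝ ∞ (fun z => (F z).1 i j) Ω) ∧
      (∀ z ∈ Ω, (F z).1.col 0 = u0 z ∧ (F z).1.col 1 = u1 z ∧ (F z).1.col 2 = u2 z ∧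
        (F z).1.col (Fin.last (n + 1)) = ul z) ∧
      ∀ z ∈ W, (A z).1.col 0 = u0 z → (A z).1.col 1 = u1 z → (A z).1.col 2 = u2 z →
        (A z).1.col (Fin.last (n + 1)) = ul z → z ∈ Ω ∧ F z = A z := by
  have l0 : (0 : Fin (n + 2)) ≠ Fin.last (n + 1) := last_ne_zero'.symm
  have l1 := one_ne_last hn
  have two : ((NormalIndex.two hn : NormalIndex n) : Fin (n + 2)) = 2 := rfl
  have t0 := (NormalIndex.two hn).ne_zero
  have t1 := (NormalIndex.two hn).ne_one
  have tl := (NormalIndex.two hn).ne_last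
  rw [two] at t0 t1 tl
  have p1 : ∀ y : Vec n, lorentzProd (stdVec 1) y = y 1 := lorentzProd_stdVec_one hn
  have p2 : ∀ y : Vec n, lorentzProd (stdVec 2) y = y 2 := lorentzProd_stdVec_of_ne t0 tl
  -- A move needs vectors of nonzero square, so the null columns 0 and `n + 1` are replaced by their
  -- sum and difference. The four vectors `cT`, `cS`, `η_1`, `η_2` are mutually orthogonal, so each
  -- correction preserves the earlier ones.
  set cT : Vec n := stdVec 0 + stdVec (Fin.last (n + 1)) with hcT
  set cS : Vec n := stdVec 0 - stdVec (Fin.last (n + 1)) with hcS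
  have hTT : lorentzProd cT cT = -2 := by
    simp [hcT]
    norm_num
  have hSS : lorentzProd cS cS = 2 := by
    simp [hcS]
    norm_num
  have hST : lorentzProd cS cT = 0 := by
    simp [hcS, hcT]
  have h1T : lorentzProd (stdVec 1) cT = 0 := by
    rw [p1, hcT]
    simp [stdVec, l1]
  have h1S : lorentzProd (stdVec 1) cS = 0 := by
    rw [p1, hcS]
    simp [stdVec, l1]
  have h11 : lorentzProd (stdVec 1 : Vec n) (stdVec 1) = 1 := by
    rw [p1]
    simp [stdVec]
  have h2T : lorentzProd (stdVec 2) cT = 0 := by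
    rw [p2, hcT]
    simp [stdVec, t0, tl]
  have h2S : lorentzProd (stdVec 2) cS = 0 := by
    rw [p2, hcS]
    simp [stdVec, t0, tl]
  have h21 : lorentzProd (stdVec 2 : Vec n) (stdVec 1) = 0 := by
    rw [p2]
    simp [stdVec, t1]
  have h22 : lorentzProd (stdVec 2 : Vec n) (stdVec 2) = 1 := by
    rw [p2]
    simp [stdVec]
  obtain ⟨W1, A1, o1, i1, sm1, e1, f1, g1⟩ := exists_steer hW hA (c := cT)
    (u := fun z => u0 z + ul z) (by rw [hTT]; norm_num) (s0.add sl) (fun z hz => by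
      obtain ⟨a00, a01, a02, a0l, a11, a12, a1l, a22, a2l, all⟩ := gram z hz
      rw [lorentzProd_add_self, hTT, a00, a0l, all]
      norm_num)
  obtain ⟨W2, A2, o2, i2, sm2, e2, f2, g2⟩ := exists_steer o1 sm1 (c := cS)
    (u := fun z => u0 z - ul z) (by rw [hSS]; norm_num) ((s0.sub sl).mono i1) (fun z hz => by
      obtain ⟨a00, a01, a02, a0l, a11, a12, a1l, a22, a2l, all⟩ := gram z (i1 hz)
      simp only [lorentzProd_sub_left, lorentzProd_sub_right, lorentzProd_comm (ul z) (u0 z), hSS,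
        a00, a0l, all]
      norm_num)
  have i12 := i2.trans i1
  obtain ⟨W3, A3, o3, i3, sm3, e3, f3, g3⟩ := exists_steer o2 sm2 (c := stdVec 1)
    (u := u1) (by rw [h11]; norm_num) (s1.mono i12) (fun z hz => by
      obtain ⟨a00, a01, a02, a0l, a11, a12, a1l, a22, a2l, all⟩ := gram z (i12 hz)
      rw [a11, h11])
  have i123 := i3.trans i12
  obtain ⟨W4, A4, o4, i4, sm4, e4, f4, g4⟩ := exists_steer o3 sm3 (c := stdVec 2)
    (u := u2) (by rw [h22]; norm_num) (s2.mono i123) (fun z hz => by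
      obtain ⟨a00, a01, a02, a0l, a11, a12, a1l, a22, a2l, all⟩ := gram z (i123 hz)
      rw [a22, h22])
  refine ⟨W4, A4, o4, i4.trans i123, sm4, fun z hz => ?_, fun z hz q0 q1 q2 ql => ?_⟩
  · have z3 := i4 hz
    have z2 := i3 z3
    have z1 := i2 z2
    obtain ⟨a00, a01, a02, a0l, a11, a12, a1l, a22, a2l, all⟩ := gram z (i1 z1)
    have T1 := e1 z z1
    have T2 : (A2 z).1 *ᵥ cT = u0 z + ul z := by
      rw [f2 z z2 cT hST, T1]
      rw [T1]
      simp [a00, a0l, all, lorentzProd_comm (ul z) (u0 z)]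
    have S2 := e2 z z2
    have T3 : (A3 z).1 *ᵥ cT = u0 z + ul z := by
      rw [f3 z z3 cT h1T, T2]
      rw [T2]
      simp [lorentzProd_comm (u1 z) (u0 z), a01, a1l]
    have S3 : (A3 z).1 *ᵥ cS = u0 z - ul z := by
      rw [f3 z z3 cS h1S, S2]
      rw [S2]
      simp [lorentzProd_comm (u1 z) (u0 z), a01, a1l]
    have O3 := e3 z z3
    have T4 : (A4 z).1 *ᵥ cT = u0 z + ul z := by
      rw [f4 z hz cT h2T, T3]
      rw [T3]
      simp [lorentzProd_comm (u2 z) (u0 z), a02, a2l]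
    have S4 : (A4 z).1 *ᵥ cS = u0 z - ul z := by
      rw [f4 z hz cS h2S, S3]
      rw [S3]
      simp [lorentzProd_comm (u2 z) (u0 z), a02, a2l]
    have O4 : (A4 z).1 *ᵥ stdVec 1 = u1 z := by
      rw [f4 z hz _ h21, O3]
      rw [O3, lorentzProd_comm, a12]
    have N4 := e4 z hz
    rw [hcT, Matrix.mulVec_add, Matrix.mulVec_single_one, Matrix.mulVec_single_one] at T4
    rw [hcS, Matrix.mulVec_sub, Matrix.mulVec_single_one, Matrix.mulVec_single_one] at S4
    rw [Matrix.mulVec_single_one] at O4 N4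
    refine ⟨?_, O4, N4, ?_⟩
    · funext i
      have := congrFun T4 i
      have := congrFun S4 i
      simp only [Pi.add_apply, Pi.sub_apply] at *
      linarith
    · funext i
      have := congrFun T4 i
      have := congrFun S4 i
      simp only [Pi.add_apply, Pi.sub_apply] at *
      linarith
  · obtain ⟨z1, w1⟩ := g1 z hz (by
      rw [hcT, Matrix.mulVec_add, Matrix.mulVec_single_one, Matrix.mulVec_single_one, q0, ql])
    obtain ⟨z2, w2⟩ := g2 z z1 (by
      rw [w1, hcS, Matrix.mulVec_sub, Matrix.mulVec_single_one, Matrix.mulVec_single_one, q0, ql])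
    obtain ⟨z3, w3⟩ := g3 z z2 (by rw [w2, w1, Matrix.mulVec_single_one, q1])
    obtain ⟨z4, w4⟩ := g4 z z3 (by rw [w3, w2, w1, Matrix.mulVec_single_one, q2])
    exact ⟨z4, by rw [w4, w3, w2, w1]⟩

/-- A smooth family of null lifts has a smooth normalized frame near the points where a given
family of Möbius transformations is normalized. -/
theorem exists_normalizedFrame (hn : 3 ≤ n) (hW : IsOpen W)
    (hA : ∀ i j, ContDiffOn ℝ ∞ (fun z => (A z).1 i j) W) {G : ℝ → ℝ → Vec n}
    (hG : ContDiffOn ℝ ∞ (fun z : ℝ × ℝ => G z.1 z.2) W)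
    (hnull : ∀ z ∈ W, lorentzProd (G z.1 z.2) (G z.1 z.2) = 0) :
    ∃ (Ω : Set (ℝ × ℝ)) (F : ℝ × ℝ → MobiusGroup n), IsOpen Ω ∧ Ω ⊆ W ∧
      (∀ i j, ContDiffOn ℝ ∞ (fun z => (F z).1 i j) Ω) ∧
      (∀ z ∈ Ω, (F z).1.col 0 = liftScale (fun y => G y z.2) z.1 • G z.1 z.2) ∧
      (∀ (t : ℝ) (f : ℝ → DarbouxQuadric n),
        (∀ x, (x, t) ∈ Ω → (F (x, t)).proj = f x) →
        IsSpecialThirdOrderFrame f {x | (x, t) ∈ Ω} fun x => F (x, t)) ∧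
      ∀ z ∈ W, 0 < speed (fun y => G y z.2) z.1 → 0 < dualLength (fun y => G y z.2) z.1 →
        (A z).1.col 0 = vecZero (fun y => G y z.2) z.1 →
        (A z).1.col 1 = vecOne (fun y => G y z.2) z.1 →
        (A z).1.col 2 = vecTwo (fun y => G y z.2) z.1 →
        (A z).1.col (Fin.last (n + 1)) = vecLast (fun y => G y z.2) z.1 → z ∈ Ω ∧ F z = A z := by
  -- Positivity of the speed is imposed before that of the dual length, because smoothness of
  -- `dualNormal` already requires it.
  set W1 : Set (ℝ × ℝ) := W ∩ (fun z => speed (fun y => G y z.2) z.1) ⁻¹' Set.Ioi 0 with hW1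
  have o1 : IsOpen W1 := by
    refine ContinuousOn.isOpen_inter_preimage ?_ hW isOpen_Ioi
    have h := ContDiffOn.partial_fst hW hG
    exact (ContDiffOn.lorentzProd h h).continuousOn.sqrt
  have i1 : W1 ⊆ W := Set.inter_subset_left
  have hs1 : ∀ z ∈ W1, 0 < speed (fun y => G y z.2) z.1 := fun z hz => hz.2
  set W2 : Set (ℝ × ℝ) := W1 ∩ (fun z => dualLength (fun y => G y z.2) z.1) ⁻¹' Set.Ioi 0 with hW2
  have o2 : IsOpen W2 := by
    refine ContinuousOn.isOpen_inter_preimage ?_ o1 isOpen_Ioi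
    have h := contDiffOn_dualNormal o1 (hG.mono i1) hs1
    exact (ContDiffOn.lorentzProd h h).continuousOn.sqrt
  have i2 : W2 ⊆ W1 := Set.inter_subset_left
  have hs : ∀ z ∈ W2, 0 < speed (fun y => G y z.2) z.1 := fun z hz => hz.1.2
  have hq : ∀ z ∈ W2, 0 < dualLength (fun y => G y z.2) z.1 := fun z hz => hz.2
  have hG2 := hG.mono (i2.trans i1)
  have hreg : ∀ (t : ℝ) (Ω : Set (ℝ × ℝ)), IsOpen Ω → Ω ⊆ W2 →
      IsRegularLift (fun y => G y t) {y | (y, t) ∈ Ω} := fun t Ω hΩ hsub =>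
    ⟨isOpen_slice_fst hΩ t, ContDiffOn.slice_fst (hG2.mono hsub) t,
      fun x hx => hnull (x, t) (i1 (i2 (hsub hx))), fun x hx => hs (x, t) (hsub hx)⟩
  obtain ⟨Ω, F, o, i, sm, hcol, hid⟩ := exists_completion hn o2
    (fun i j => (hA i j).mono (i2.trans i1))
    (contDiffOn_vecZero o2 hG2 hs hq) (contDiffOn_vecOne o2 hG2 hs hq)
    (contDiffOn_vecTwo o2 hG2 hs hq) (contDiffOn_vecLast o2 hG2 hs hq) fun z hz =>
    (hreg z.2 W2 o2 subset_rfl).gram (fun x hx => hq (x, z.2) hx) hz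
  refine ⟨Ω, F, o, i.trans (i2.trans i1), sm, fun z hz => (hcol z hz).1, fun t f hf => ?_,
    fun z hz q1 q2 c0 c1 c2 cl => hid z ⟨⟨hz, q1⟩, q2⟩ c0 c1 c2 cl⟩
  · refine isSpecialThirdOrderFrame_of_cols hn (hreg t Ω o i) (fun x hx => hq (x, t) (i hx))
      (fun k j => ?_) hf (fun x hx => (hcol _ hx).1) (fun x hx => (hcol _ hx).2.1)
      (fun x hx => (hcol _ hx).2.2.1) (fun x hx => (hcol _ hx).2.2.2)
    exact ContDiffOn.slice_fst (G := fun x t => (F (x, t)).1 k j) (sm k j) t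

end Completion

/-! ### From frames back to curves in the quadric. -/

section Projection

variable {n : ℕ} {f f' : ℝ → DarbouxQuadric n} {V V' : Set ℝ} {x : ℝ} {e : ℝ → MobiusGroup n}

theorem MobiusGroup.coord_proj (G : MobiusGroup n) : G.proj.coord =
    (G.1.col 0 0 + G.1.col 0 (Fin.last (n + 1)))⁻¹ • G.1.col 0 := by
  obtain ⟨a, ha⟩ := Projectivization.exists_smul_eq_mk_rep ℝ (G.1.col 0) G.col_zero_ne_zero
  have ha' : G.proj.1.rep = (a : ℝ) • G.1.col 0 := ha.symm
  have hne : (a : ℝ) ≠ 0 := a.ne_zero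
  rw [DarbouxQuadric.coord, ha', smul_smul]
  congr 1
  simp only [Pi.smul_apply, smul_eq_mul]
  rw [← mul_add, mul_inv, mul_comm, ← mul_assoc, mul_inv_cancel₀ hne, one_mul]

theorem MobiusGroup.proj_eq_of_col {G H : MobiusGroup n} {r : ℝ}
    (h : G.1.col 0 = r • H.1.col 0) : G.proj = H.proj := by
  apply Subtype.ext
  refine (Projectivization.mk_eq_mk_iff' ℝ _ _ _ _).2 ⟨r, h.symm⟩

theorem MobiusGroup.coord_denom_ne_zero (G : MobiusGroup n) :
    G.1.col 0 0 + G.1.col 0 (Fin.last (n + 1)) ≠ 0 :=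
  sum_ne_zero_of_lorentzForm_eq_zero G.col_zero_ne_zero G.lorentzForm_col_zero

/-- The coordinate of the projected point is the first column divided by the sum of its entries 0
and `n + 1`, which is nonzero for a nonzero null vector. -/
theorem contDiffOn_coord {E : Type*} [NormedAddCommGroup E] [NormedSpace ℝ E] {W : Set E}
    {F : E → MobiusGroup n} {v : E → DarbouxQuadric n}
    (hF : ∀ i j, ContDiffOn ℝ ∞ (fun z => (F z).1 i j) W) (hv : ∀ z ∈ W, (F z).proj = v z) :
    ContDiffOn ℝ ∞ (fun z => (v z).coord) W := by
  have h1 : ContDiffOn ℝ ∞ (fun z => (F z).1.col 0) W := contDiffOn_pi.2 fun i => hF i 0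
  refine ContDiffOn.congr ((((hF 0 0).add (hF (Fin.last (n + 1)) 0)).inv
    fun z _ => (F z).coord_denom_ne_zero).smul h1) fun z hz => ?_
  rw [← hv z hz, MobiusGroup.coord_proj]
  rfl

/-- A curve with a first order frame is an immersion. -/
theorem IsFirstOrderFrame.deriv_coord_ne_zero (hn : 3 ≤ n) (hV : IsOpen V)
    (he : IsFirstOrderFrame f V e) (hx : x ∈ V) : deriv (fun y => (f y).coord) x ≠ 0 := by
  intro hz
  have hd := differentiableAt_frameCol hV he.smooth hx
  have hc : DifferentiableAt ℝ (fun y => (f y).coord) x :=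
    ContDiffOn.differentiableAt_of_isOpen hV (contDiffOn_coord he.smooth he.proj_eq) hx
  set m : ℝ → ℝ := fun y => frameCol e 0 y 0 + frameCol e 0 y (Fin.last (n + 1)) with hm
  have hmd : DifferentiableAt ℝ m x :=
    (differentiableAt_pi.1 (hd 0) 0).add (differentiableAt_pi.1 (hd 0) _)
  have hfac : ∀ y ∈ V, frameCol e 0 y = m y • (f y).coord := fun y hy => by
    rw [← he.proj_eq y hy, MobiusGroup.coord_proj, smul_smul,
      mul_inv_cancel₀ (e y).coord_denom_ne_zero, one_smul]
  -- If the curve has zero velocity, the derivative of the first column is parallel to that column,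
  -- which forces `φ^1_0 = 0`.
  have hder : deriv (frameCol e 0) x = deriv m x • (f x).coord := by
    have h1 : frameCol e 0 =ᶠ[nhds x] fun y => m y • (f y).coord := by
      filter_upwards [hV.mem_nhds hx] with y hy using hfac y hy
    have h2 := hmd.hasDerivAt.smul hc.hasDerivAt
    rw [h1.deriv_eq]
    refine h2.deriv.trans ?_
    rw [hz, smul_zero, zero_add]
  have h3 := he.oriented x hx
  rw [mcForm_of_ne hd (by simp) (one_ne_last hn), hder, ← he.proj_eq x hx,
    MobiusGroup.coord_proj, lorentzProd_smul_right, lorentzProd_smul_right,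
    lorentzProd_col_of_ne _ (by simp) (one_ne_last hn), if_neg (by simp)] at h3
  simp at h3

theorem IsSecondOrderFrame.mono (he : IsSecondOrderFrame f V e) (h : V' ⊆ V)
    (hf : ∀ x ∈ V', f' x = f x) : IsSecondOrderFrame f' V' e :=
  ⟨⟨⟨fun i j => (he.smooth i j).mono h, fun x hx => (he.proj_eq x (h hx)).trans (hf x hx).symm⟩,
    fun x hx => he.phi_normal_zero x (h hx), fun x hx => he.oriented x (h hx)⟩,
    fun x hx => he.phi_normal_one x (h hx)⟩

theorem IsSpecialThirdOrderFrame.mono (he : IsSpecialThirdOrderFrame f V e) (h : V' ⊆ V)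
    (hf : ∀ x ∈ V', f' x = f x) : IsSpecialThirdOrderFrame f' V' e :=
  ⟨⟨he.toIsSecondOrderFrame.mono h hf, fun x hx => he.phi_zero_two x (h hx),
    fun x hx => he.phi_zero_b x (h hx)⟩, fun x hx => he.phi_zero_zero x (h hx)⟩

/-- A curve with a third order frame is `1`-generic. -/
theorem IsThirdOrderFrame.isOneGenericAt (hn : 3 ≤ n) (hV : IsOpen V)
    (he : IsThirdOrderFrame f V e) (hx : x ∈ V) : IsOneGenericAt f x := by
  refine ⟨V, e, hV, hx, he.toIsSecondOrderFrame, ?_⟩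
  have h2 : pCoeff e x (NormalIndex.two hn) = 1 := by
    have h3 : mcForm e x 0 (NormalIndex.two hn : NormalIndex n) = mcForm e x 1 0 :=
      he.phi_zero_two x hx
    rw [pCoeff, h3, div_self (he.oriented x hx).ne']
  have h4 := Finset.single_le_sum (f := fun α : NormalIndex n => pCoeff e x α ^ 2)
    (fun α _ => sq_nonneg _) (Finset.mem_univ (NormalIndex.two hn))
  simp only [h2] at h4
  intro h0
  rw [h0] at h4
  norm_num at h4

/-- A `1`-generic curve has a special third order frame near each point. -/
theorem IsOneGenericAt.exists_specialFrame (hn : 3 ≤ n) {p : ℝ} (h : IsOneGenericAt f p)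
    {I : Set ℝ} (hI : IsOpen I) (hp : p ∈ I) : ∃ (U : Set ℝ) (e : ℝ → MobiusGroup n),
      IsOpen U ∧ p ∈ U ∧ U ⊆ I ∧ IsSpecialThirdOrderFrame f U e := by
  obtain ⟨V, e, hV, hpV, he, hgen⟩ := h
  obtain ⟨hlen, M, m0, m1, m2, ml⟩ := he.exists_normalized hn hV hpV hgen
  have hspeed := (he.frenet (g := frameCol e 0) hn hV fun _ _ => rfl).1.speed_pos p hpV
  -- The constant family `M` serves as reference. It matches the normalized columns at `p`, which is
  -- enough to place `(p, 0)` in the open set `Ω`.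
  obtain ⟨Ω, F, o, i, -, hcol, hspecial, hid⟩ := exists_normalizedFrame hn
    (W := (V ∩ I) ×ˢ Set.univ) ((hV.inter hI).prod isOpen_univ) (A := fun _ => M)
    (fun _ _ => contDiffOn_const) (G := fun x _ => frameCol e 0 x)
    (ContDiffOn.prod_const ((contDiffOn_frameCol he.smooth 0).mono Set.inter_subset_left))
    fun z _ => by rw [lorentzProd_col_zero, if_neg last_ne_zero'.symm]
  refine ⟨{x | (x, 0) ∈ Ω}, fun x => F (x, 0), isOpen_slice_fst o 0,
    (hid (p, 0) ⟨⟨hpV, hp⟩, trivial⟩ hspeed hlen m0 m1 m2 ml).1, fun x hx => (i hx).1.2,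
    hspecial 0 f fun x hx => ?_⟩
  rw [← he.proj_eq x (i hx).1.1]
  exact MobiusGroup.proj_eq_of_col (hcol _ hx)

end Projection

/-! ### The varied null lift and its velocity. -/

section Variation

variable {n : ℕ}

/-- The variation vector `∑ λ^α e_α`. -/
def variationVec (e : ℝ → MobiusGroup n) (lam : NormalIndex n → ℝ → ℝ) (x : ℝ) : Vec n :=
  ∑ α : NormalIndex n, lam α x • frameCol e α x

/-- The lift of the variation. -/
def variationLift (e : ℝ → MobiusGroup n) (lam : NormalIndex n → ℝ → ℝ) (x t : ℝ) : Vec n :=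
  frameCol e 0 x + t • variationVec e lam x +
    (t ^ 2 / 2 * ∑ α : NormalIndex n, lam α x ^ 2) • frameCol e (Fin.last (n + 1)) x

variable (e : ℝ → MobiusGroup n) (lam : NormalIndex n → ℝ → ℝ) (x t : ℝ)

theorem prod_col_variationVec (α : NormalIndex n) :
    lorentzProd (frameCol e α x) (variationVec e lam x) = lam α x := by
  rw [variationVec, lorentzProd_sum_right, Finset.sum_eq_single α]
  · rw [lorentzProd_smul_right, lorentzProd_col_of_ne _ α.ne_zero α.ne_last, if_pos rfl, mul_one]
  · intro β _ hβ
    rw [lorentzProd_smul_right, lorentzProd_col_of_ne _ α.ne_zero α.ne_last,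
      if_neg fun h => hβ (Subtype.ext h.symm), mul_zero]
  · simp

theorem prod_zero_variationVec : lorentzProd (frameCol e 0 x) (variationVec e lam x) = 0 := by
  rw [variationVec, lorentzProd_sum_right]
  refine Finset.sum_eq_zero fun α _ => ?_
  rw [lorentzProd_smul_right, lorentzProd_col_zero, if_neg α.ne_last, mul_zero]

theorem prod_last_variationVec :
    lorentzProd (frameCol e (Fin.last (n + 1)) x) (variationVec e lam x) = 0 := by
  rw [variationVec, lorentzProd_sum_right]
  refine Finset.sum_eq_zero fun α _ => ?_
  rw [lorentzProd_smul_right, lorentzProd_col_last, if_neg α.ne_zero, mul_zero]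

theorem prod_variationVec_self :
    lorentzProd (variationVec e lam x) (variationVec e lam x) =
      ∑ α : NormalIndex n, lam α x ^ 2 := by
  conv_lhs => rw [variationVec.eq_1 e lam x, lorentzProd_sum_left]
  refine Finset.sum_congr rfl fun α _ => ?_
  rw [lorentzProd_smul_left, ← variationVec.eq_1, prod_col_variationVec, pow_two]

/-- The term `t^2 |λ|^2` from the normal part cancels against twice the product of `e_0` with the
`e_{n+1}` term. -/
theorem variationLift_null :
    lorentzProd (variationLift e lam x t) (variationLift e lam x t) = 0 := by
  have c00 : lorentzProd (frameCol e 0 x) (frameCol e 0 x) = 0 := by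
    rw [lorentzProd_col_zero, if_neg last_ne_zero'.symm]
  have c0l : lorentzProd (frameCol e 0 x) (frameCol e (Fin.last (n + 1)) x) = -1 := by
    rw [lorentzProd_col_zero, if_pos rfl]
  have cl0 : lorentzProd (frameCol e (Fin.last (n + 1)) x) (frameCol e 0 x) = -1 := by
    rw [lorentzProd_comm, c0l]
  have cll : lorentzProd (frameCol e (Fin.last (n + 1)) x)
      (frameCol e (Fin.last (n + 1)) x) = 0 := by
    rw [lorentzProd_col_last, if_neg last_ne_zero']
  have w0 := prod_zero_variationVec e lam x
  have wl := prod_last_variationVec e lam x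
  simp only [variationLift, lorentzProd_add_left, lorentzProd_add_right, lorentzProd_smul_left,
    lorentzProd_smul_right, c00, c0l, cl0, cll, w0, wl, prod_variationVec_self,
    lorentzProd_comm (variationVec e lam x) (frameCol e _ x)]
  ring

theorem prod_col_variationLift (α : NormalIndex n) :
    lorentzProd (frameCol e α x) (variationLift e lam x t) = t * lam α x := by
  simp only [variationLift, lorentzProd_add_right, lorentzProd_smul_right, prod_col_variationVec]
  rw [lorentzProd_col_of_ne _ α.ne_zero α.ne_last, if_neg α.ne_zero,
    lorentzProd_col_of_ne _ α.ne_zero α.ne_last, if_neg α.ne_last]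
  ring

theorem prod_last_variationLift :
    lorentzProd (frameCol e (Fin.last (n + 1)) x) (variationLift e lam x t) = -1 := by
  simp only [variationLift, lorentzProd_add_right, lorentzProd_smul_right, prod_last_variationVec]
  rw [lorentzProd_col_last, if_pos rfl, lorentzProd_col_last, if_neg last_ne_zero']
  ring

theorem variationLift_zero : variationLift e lam x 0 = frameCol e 0 x := by
  simp [variationLift]

variable {e lam x t} {U I : Set ℝ}

theorem variationLift_of_lam_eq_zero (h : ∀ α, lam α x = 0) :
    variationLift e lam x t = frameCol e 0 x := by
  simp [variationLift, variationVec, h]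

theorem contDiffOn_variationLift (he : ∀ i j, ContDiffOn ℝ ∞ (fun x => (e x).1 i j) U)
    (hlam : ∀ α, ContDiffOn ℝ ∞ (lam α) U) :
    ContDiffOn ℝ ∞ (fun z : ℝ × ℝ => variationLift e lam z.1 z.2) (U ×ˢ Set.univ) := by
  have hc := fun j => ContDiffOn.prod_const (contDiffOn_frameCol he j)
  have hl := fun α => ContDiffOn.prod_const (hlam α)
  have h2 : ContDiffOn ℝ ∞ (fun z : ℝ × ℝ => z.2) (U ×ˢ Set.univ) := contDiffOn_snd
  exact ((hc 0).add (h2.smul (ContDiffOn.sum fun α _ => (hl α).smul (hc α)))).add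
    ((((h2.pow 2).div_const 2).mul (ContDiffOn.sum fun α _ => (hl α).pow 2)).smul (hc _))

/-- The normal part of the velocity of a frame whose first column is a multiple of the variation
lift. -/
theorem variationCoeff_eq {F : ℝ → ℝ → MobiusGroup n} {r : ℝ → ℝ}
    (hF : ∀ j, DifferentiableAt ℝ (frameCol (fun s => F x s) j) 0) (h0 : F x 0 = e x)
    (hr : ∀ᶠ s in nhds 0, (F x s).1.col 0 = r s • variationLift e lam x s) (α : NormalIndex n) :
    variationCoeff F α x 0 = lam α x := by
  rw [variationCoeff, dtCoeff, mcForm_of_ne hF α.ne_zero α.ne_last]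
  set c : ℝ → Vec n := frameCol (fun s => F x s) 0 with hc
  have hprod : ∀ a : Vec n,
      HasDerivAt (fun s => lorentzProd a (c s)) (lorentzProd a (deriv c 0)) 0 := fun a => by
    have := hasDerivAt_lorentzProd (hasDerivAt_const (0 : ℝ) a) (hF 0).hasDerivAt
    simpa using this
  have h1 := hprod (frameCol e α x)
  have h2 := ((hprod (frameCol e (Fin.last (n + 1)) x)).neg.mul
    ((hasDerivAt_id (0 : ℝ)).mul_const (lam α x)))
  -- Both products contain the factor `r s`, so it is eliminated without any differentiability of
  -- `r`. At `s = 0` the factor `-⟨e_{n+1}, c⟩` equals 1, and the derivative of the right side is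
  -- `λ^α`.
  have heq : (fun s => lorentzProd (frameCol e α x) (c s)) =ᶠ[nhds 0]
      fun s => -lorentzProd (frameCol e (Fin.last (n + 1)) x) (c s) * (s * lam α x) := by
    filter_upwards [hr] with s hs
    have hs' : c s = r s • variationLift e lam x s := hs
    rw [hs', lorentzProd_smul_right, lorentzProd_smul_right, prod_col_variationLift,
      prod_last_variationLift]
    ring
  have h3 := (h1.congr_of_eventuallyEq heq.symm).unique h2
  have hc0 : c 0 = frameCol e 0 x := by rw [hc, frameCol, h0]
  change lorentzProd ((F x 0).1.col α) (deriv c 0) = lam α x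
  rw [h0, h3]
  simp [hc0, lorentzProd_col_last]

end Variation

end

end ConformalCurves

/-! ### Assembly of the variation. -/

theorem mainTheorem10 (n : ℕ) (hn : 3 ≤ n) (I : Set ℝ) (hIo : IsOpen I) (hIc : I.OrdConnected)
    (f : ℝ → ConformalCurves.DarbouxQuadric n)
    (hf : ConformalCurves.IsOneGenericImmersionOn f I) :
    ∀ p ∈ I, ∃ U : Set ℝ, IsOpen U ∧ p ∈ U ∧ U ⊆ I ∧
      ∀ (lam : ConformalCurves.NormalIndex n → ℝ → ℝ) (C : Set ℝ),
        (∀ α, ContDiffOn ℝ ∞ (lam α) I) → IsCompact C → C ⊆ U →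
        (∀ α, ∀ x ∈ I \ C, lam α x = 0) →
        ∃ (ε : ℝ) (K : Set ℝ) (v : ℝ → ℝ → ConformalCurves.DarbouxQuadric n)
          (e : ℝ → ℝ → ConformalCurves.MobiusGroup n),
          0 < ε ∧ K ⊆ U ∧
          ConformalCurves.IsAdmissibleVariation f I ε K v ∧
          ConformalCurves.IsSpecialThirdOrderFrameAlong ε K v U e ∧
          ∀ α, ∀ x ∈ U, ConformalCurves.variationCoeff e α x 0 = lam α x := by
  classical
  open ConformalCurves in
  intro p hp
  obtain ⟨U, e, hU, hpU, hUI, he⟩ := (hf.2 p hp).exists_specialFrame hn hIo hp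
  refine ⟨U, hU, hpU, hUI, fun lam C hlam hC hCU hlamC => ?_⟩
  obtain ⟨Ω, F, o, i, sm, hcol, hspecial, hid⟩ := exists_normalizedFrame hn
    (W := U ×ˢ Set.univ) (hU.prod isOpen_univ) (A := fun z => e z.1)
    (fun k j => ContDiffOn.prod_const (he.smooth k j)) (G := variationLift e lam)
    (contDiffOn_variationLift he.smooth fun α => (hlam α).mono hUI)
    fun z _ => variationLift_null e lam z.1 z.2
  -- At `t = 0` the varied lift is the first column of `e`, whose normalized frame is `e` itself;
  -- the correction is therefore trivial.
  have mem0 : ∀ x ∈ U, (x, (0 : ℝ)) ∈ Ω ∧ F (x, 0) = e x := fun x hx => by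
    obtain ⟨s, l, c0, c1, c2, cl⟩ := he.frenet (g := fun y => variationLift e lam y 0) hn hU
      (fun y _ => variationLift_zero e lam y) hx
    exact hid (x, 0) ⟨hx, trivial⟩ s l c0.symm c1.symm c2.symm cl.symm
  -- The set `U \ C` is open and the lift there is `e_0` for every `t`. The `x`-derivatives in the
  -- Frenet vectors therefore also agree with those of `e`.
  have memC : ∀ x ∈ U \ C, ∀ t : ℝ, (x, t) ∈ Ω ∧ F (x, t) = e x := fun x hx t => by
    obtain ⟨s, l, c0, c1, c2, cl⟩ := (he.mono (V' := U \ C) Set.sdiff_subset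
      fun _ _ => rfl).frenet (g := fun y => variationLift e lam y t) hn (hU.sdiff hC.isClosed)
      (fun y hy => variationLift_of_lam_eq_zero fun α => hlamC α y ⟨hUI hy.1, hy.2⟩) hx
    exact hid (x, t) ⟨hx.1, trivial⟩ s l c0.symm c1.symm c2.symm cl.symm
  -- A uniform `ε` is needed only over the compact set `C`, since points outside `C` lie in `Ω` for
  -- all `t`.
  obtain ⟨ε, hε, htube⟩ : ∃ ε : ℝ, 0 < ε ∧ U ×ˢ Set.Ioo (-ε) ε ⊆ Ω := by
    obtain ⟨u, w, -, hw, hCu, h0w, huw⟩ := generalized_tube_lemma hC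
      (isCompact_singleton (x := (0 : ℝ))) o (by
        rintro ⟨x, t⟩ ⟨hx, rfl⟩
        exact (mem0 x (hCU hx)).1)
    obtain ⟨ε, hε, hball⟩ := Metric.isOpen_iff.1 hw 0 (h0w rfl)
    refine ⟨ε, hε, ?_⟩
    rintro ⟨x, t⟩ ⟨hx, ht⟩
    by_cases hxC : x ∈ C
    · refine huw ⟨hCu hxC, hball ?_⟩
      rw [Real.ball_eq_Ioo]
      simpa using ht
    · exact (memC x ⟨hx, hxC⟩ t).1
  -- The two definitions agree on `U \ C`. The open set `Ω` and the open strip over `I \ C` together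
  -- cover the domain, so smoothness can be checked on each. The support is `K = C`.
  set v : ℝ → ℝ → DarbouxQuadric n := fun x t => if x ∈ U then (F (x, t)).proj else f x with hv
  have hvU : ∀ x ∈ U, ∀ t, (F (x, t)).proj = v x t := fun x hx t => by
    simp only [hv, if_pos hx]
  have hvC : ∀ x, x ∉ C → ∀ t, v x t = f x := fun x hx t => by
    by_cases hxU : x ∈ U
    · rw [← hvU x hxU, (memC x ⟨hxU, hx⟩ t).2, he.proj_eq x hxU]
    · simp only [hv, if_neg hxU]
  have hframe : ∀ t ∈ Set.Ioo (-ε) ε,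
      IsSpecialThirdOrderFrame (fun x => v x t) U fun x => F (x, t) := fun t ht =>
    (hspecial t (fun x => (F (x, t)).proj) fun _ _ => rfl).mono
      (fun x hx => htube ⟨hx, ht⟩) fun x hx => (hvU x hx t).symm
  have hsmooth : ContDiffOn ℝ ∞ (fun z : ℝ × ℝ => (v z.1 z.2).coord) (I ×ˢ Set.Ioo (-ε) ε) := by
    rintro ⟨x, t⟩ ⟨hx, ht⟩
    apply ContDiffAt.contDiffWithinAt
    by_cases hxU : x ∈ U
    · have h1 : ContDiffOn ℝ ∞ (fun z : ℝ × ℝ => (v z.1 z.2).coord) Ω :=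
        contDiffOn_coord sm fun z hz => hvU z.1 (i hz).1 z.2
      exact h1.contDiffAt (o.mem_nhds (htube ⟨hxU, ht⟩))
    · have h1 : ContDiffOn ℝ ∞ (fun z : ℝ × ℝ => (v z.1 z.2).coord) ((I \ C) ×ˢ Set.univ) :=
        (ContDiffOn.prod_const (hf.1.1.mono Set.sdiff_subset)).congr fun z hz => by
          rw [hvC z.1 hz.1.2]
      exact h1.contDiffAt (((hIo.sdiff hC.isClosed).prod isOpen_univ).mem_nhds
        ⟨⟨hx, fun h => hxU (hCU h)⟩, trivial⟩)
  refine ⟨ε, C, v, fun x t => F (x, t), hε, hCU,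
    ⟨hC, hCU.trans hUI, hsmooth, fun t ht => ⟨⟨?_, fun x hx => ?_⟩, fun q hq => ?_⟩,
      fun x hx => ?_, fun x hx t _ => hvC x hx.2 t⟩,
    ⟨fun k j => (sm k j).mono htube, fun x hx t _ => hvU x hx t, fun x hx t _ => ?_, hframe⟩,
    fun α x hx => ?_⟩
  · exact (ContDiffOn.slice_fst (G := fun x t => (v x t).coord) hsmooth t).mono
      fun x hx => ⟨hx, ht⟩
  · by_cases hxU : x ∈ U
    · exact (hframe t ht).toIsFirstOrderFrame.deriv_coord_ne_zero hn hU hxU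
    · have h1 : (fun y => (v y t).coord) =ᶠ[nhds x] fun y => (f y).coord := by
        filter_upwards [hC.isClosed.isOpen_compl.mem_nhds fun h => hxU (hCU h)] with y hy
        rw [hvC y hy]
      rw [h1.deriv_eq]
      exact hf.1.2 x hx
  · by_cases hqU : q ∈ U
    · exact (hframe t ht).toIsThirdOrderFrame.isOneGenericAt hn hU hqU
    -- Outside `U` the curve `f_t` coincides with `f` near `q`, so a frame of `f` restricted to `V \
    -- C` certifies genericity.
    · obtain ⟨V, e', hV, hqV, he', hgen⟩ := hf.2 q hq
      exact ⟨V \ C, e', hV.sdiff hC.isClosed, ⟨hqV, fun h => hqU (hCU h)⟩,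
        he'.mono Set.sdiff_subset fun y hy => hvC y hy.2 t, hgen⟩
  · by_cases hxU : x ∈ U
    · rw [← hvU x hxU, (mem0 x hxU).2, he.proj_eq x hxU]
    · simp only [hv, if_neg hxU]
  · exact (memC x hx t).2.trans (mem0 x hx.1).2.symm
  · have hopen : IsOpen {s : ℝ | (x, s) ∈ Ω} :=
      o.preimage (by fun_prop : Continuous fun s : ℝ => (x, s))
    refine variationCoeff_eq (r := fun s => liftScale (fun y => variationLift e lam y s) x)
      (fun j => differentiableAt_pi.2 fun k => ?_) (mem0 x hx).2 ?_ α
    · exact ContDiffOn.differentiableAt_of_isOpen hopen (ContDiffOn.comp (t := Ω) (sm k j)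
        (f := fun s : ℝ => (x, s)) (by fun_prop) fun _ h => h) (mem0 x hx).1
    · filter_upwards [hopen.mem_nhds (mem0 x hx).1] with s hs using hcol _ hs
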